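/- Let $P\subset\mathbb{R}^n$ be a smooth lattice polytope, that is, an $n$-dimensional polytope whose vertices lie in $\mathbb{Z}^n$, with exactly $n$ edges at each vertex, with rational edge directions, and such that the primitive edge-direction vectors at each vertex form a basis of $\mathbb{Z}^n$. For a nonempty face $F$ of $P$ (with $F=P$ allowed), let $u_i\cdot x\le b_i$ ($i=1,\dots,k$, with $u_i\in\mathbb{Z}^n$ primitive) be the inequalities defining the facets of $P$ that contain $F$; the first displacement of $F$ is $$F_0 := P\cap\{x\in\mathbb{R}^n : u_i\cdot x=b_i-1 \text{ for all } i=1,\dots,k\}.$$ Then the following are equivalent: (i) $P$ is deeply smooth: for every vertex $v$ of $P$, with primitive edge vectors $u_1,\dots,u_n$ at $v$, the parallelepiped $\{v+\sum_{i=1}^n\lambda_i u_i : \lambda_i\in[0,1]\ \forall i\}$ is contained in $P$; (ii) for every nonempty face $F$ of $P$, the first displacement $F_0$ is normally isomorphic to $F$, that is, $F_0$ and $F$ have the same normal fan in $\mathbb{R}^n$; (iii) $P$ and the first displacements $F_0$ of all its nonempty faces $F$ are UT-free, that is, none of them has a $2$-dimensional face that is a unimodular triangle (a triangle with lattice vertices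 $p,q,r$ such that $q-p,\,r-p$ is a basis of the lattice of integer points in the plane that they span). -/

import Mathlib

namespace LatticePolytope

/-- The lattice `ℤⁿ` inside `ℝⁿ`: an integer vector viewed as a real vector. -/
def toReal {n : ℕ} (z : Fin n → ℤ) : Fin n → ℝ := fun i => (z i : ℝ)

/-- A polytope is the convex hull of finitely many points. -/
def IsPolytope {n : ℕ} (P : Set (Fin n → ℝ)) : Prop :=
  ∃ s : Set (Fin n → ℝ), s.Finite ∧ P = convexHull ℝ s

/-- A (nonempty) face of `P`: the set of points of `P` where some linear functional attains its
maximum over `P`. The zero functional gives `P` itself. -/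
def IsFace {n : ℕ} (P F : Set (Fin n → ℝ)) : Prop :=
  F.Nonempty ∧ IsExposed ℝ P F

/-- The dimension of (the affine hull of) a nonempty set. -/
noncomputable def dim {n : ℕ} (F : Set (Fin n → ℝ)) : ℕ :=
  Module.finrank ℝ (vectorSpan ℝ F)

/-- The vertices of `P`. -/
def IsVertex {n : ℕ} (P : Set (Fin n → ℝ)) (v : Fin n → ℝ) : Prop :=
  IsFace P {v}

/-- The edges of `P`: its faces of dimension one. -/
def IsEdge {n : ℕ} (P e : Set (Fin n → ℝ)) : Prop :=
  IsFace P e ∧ dim e = 1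

/-- The facets of an `n`-dimensional polytope in `ℝⁿ`: its faces of codimension one. -/
def IsFacet {n : ℕ} (P G : Set (Fin n → ℝ)) : Prop :=
  IsFace P G ∧ dim G + 1 = n

/-- A primitive lattice vector: its coordinates have greatest common divisor one. -/
def IsPrimitive {n : ℕ} (u : Fin n → ℤ) : Prop :=
  Finset.univ.gcd u = 1

/-- `u` is the primitive direction vector of an edge of `P` that starts at `v`. -/
def IsPrimitiveEdgeVector {n : ℕ} (P : Set (Fin n → ℝ)) (v : Fin n → ℝ) (u : Fin n → ℤ) : Prop :=
  IsPrimitive u ∧ ∃ t : ℝ, 0 < t ∧ IsEdge P (segment ℝ v (v + t • toReal u))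

/-- Smooth polytopes: full-dimensional polytopes in `ℝⁿ` that are simple, rational, and whose
primitive edge vectors at each vertex form a basis of `ℤⁿ`. -/
structure IsSmooth {n : ℕ} (P : Set (Fin n → ℝ)) : Prop where
  polytope : IsPolytope P
  fullDimensional : affineSpan ℝ P = ⊤
  simple : ∀ v, IsVertex P v → {e | IsEdge P e ∧ v ∈ e}.encard = n
  rational : ∀ e, IsEdge P e →
    ∃ u : Fin n → ℤ, u ≠ 0 ∧ vectorSpan ℝ e = Submodule.span ℝ {toReal u}
  unimodular : ∀ v, IsVertex P v →
    ∃ b : Module.Basis (Fin n) ℤ (Fin n → ℤ), Set.range b = {u | IsPrimitiveEdgeVector P v u}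

/-- Lattice polytopes: polytopes all of whose vertices are lattice points. -/
structure IsLattice {n : ℕ} (P : Set (Fin n → ℝ)) : Prop where
  polytope : IsPolytope P
  vertices : ∀ v, IsVertex P v → ∃ z : Fin n → ℤ, v = toReal z

/-- The parallelepiped `{v + ∑ᵢ λᵢ uᵢ | 0 ≤ λᵢ ≤ 1}`. -/
def cornerParallelepiped {n : ℕ} (v : Fin n → ℝ) (u : Fin n → Fin n → ℤ) : Set (Fin n → ℝ) :=
  {x | ∃ c : Fin n → ℝ, (∀ i, c i ∈ Set.Icc (0 : ℝ) 1) ∧ x = v + ∑ i, c i • toReal (u i)}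

/-- Deeply smooth polytopes: smooth lattice polytopes that contain, at each vertex `v`, the
parallelepiped spanned by the primitive edge vectors `u₁, …, uₙ` at `v`. -/
structure IsDeeplySmooth {n : ℕ} (P : Set (Fin n → ℝ)) : Prop where
  smooth : IsSmooth P
  lattice : IsLattice P
  corner : ∀ v, IsVertex P v → ∃ u : Fin n → Fin n → ℤ, Function.Injective u ∧
    Set.range u = {w | IsPrimitiveEdgeVector P v w} ∧ cornerParallelepiped v u ⊆ P

/-- `u ⬝ x ≤ b`, with `u` a primitive lattice vector, is a facet-defining inequality of `P`. -/
def IsFacetInequality {n : ℕ} (P : Set (Fin n → ℝ)) (u : Fin n → ℤ) (b : ℝ) : Prop :=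
  IsPrimitive u ∧ (∀ x ∈ P, toReal u ⬝ᵥ x ≤ b) ∧ IsFacet P {x | x ∈ P ∧ toReal u ⬝ᵥ x = b}

/-- The first displacement of the face `F` of `P`: in the inequality `u ⬝ x ≤ b` of each facet of
`P` that contains `F`, impose `u ⬝ x = b - 1`. (A face of codimension `k` of a simple polytope lies
in exactly `k` facets, and is their intersection.) -/
def firstDisplacement {n : ℕ} (P F : Set (Fin n → ℝ)) : Set (Fin n → ℝ) :=
  {x | x ∈ P ∧ ∀ (u : Fin n → ℤ) (b : ℝ), IsFacetInequality P u b →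
    (∀ y ∈ F, toReal u ⬝ᵥ y = b) → toReal u ⬝ᵥ x = b - 1}

/-- The normal cone of `P` at `F`: the functionals (written as vectors, via the dot product) whose
maximum over `P` is attained at every point of `F`. -/
def normalCone {n : ℕ} (P F : Set (Fin n → ℝ)) : Set (Fin n → ℝ) :=
  {c | ∀ x ∈ F, ∀ y ∈ P, c ⬝ᵥ y ≤ c ⬝ᵥ x}

/-- The normal fan of `P`: the collection of normal cones at the nonempty faces of `P`. -/
def normalFan {n : ℕ} (P : Set (Fin n → ℝ)) : Set (Set (Fin n → ℝ)) :=
  {C | ∃ F, IsFace P F ∧ C = normalCone P F}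

/-- Polytopes in the same space are normally isomorphic if they have the same normal fan. -/
def NormallyIsomorphic {n : ℕ} (P Q : Set (Fin n → ℝ)) : Prop :=
  normalFan P = normalFan Q

/-- A unimodular triangle: a triangle with lattice vertices `p, q, r` such that `q - p, r - p` is a
basis of the lattice of integer points of the plane that they span. -/
def IsUnimodularTriangle {n : ℕ} (T : Set (Fin n → ℝ)) : Prop :=
  ∃ p q r : Fin n → ℤ, T = convexHull ℝ {toReal p, toReal q, toReal r} ∧
    LinearIndependent ℤ ![q - p, r - p] ∧
    ∀ z : Fin n → ℤ, toReal z ∈ Submodule.span ℝ {toReal (q - p), toReal (r - p)} →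
      z ∈ Submodule.span ℤ {q - p, r - p}

/-- `P` is UT-free if none of its two-dimensional faces is a unimodular triangle. -/
def IsUTFree {n : ℕ} (P : Set (Fin n → ℝ)) : Prop :=
  ∀ T, IsFace P T → dim T = 2 → ¬ IsUnimodularTriangle T

end LatticePolytope

/-!
At a vertex `v` of a smooth polytope `P` the primitive edge vectors `w i` and their dual basis `a i`
form a frame (`IsFrame`): `P` lies in the cone spanned by the `w i` (`IsSmooth.sub_mem_span`), and
the facets through `v` are exactly the coordinate hyperplanes `a i ⬝ (x - v) = 0`
(`IsFrame.isFacetInequality`, `IsFrame.exists_eq_neg`). A face through `v` is given by the vanishing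
of the coordinates in a set `R`, and its first displacement by the value `1` of the same
coordinates. By convexity, deep smoothness says that all corners `v + ∑ i ∈ S, w i` belong to `P`
(`isDeeplySmooth_iff`).

If all corners belong to `P`, a face `F` at its vertex `v` and its displacement at the corner
`v + ∑ i ∈ R, w i` have the same local cone. Local cones determine normal fans
(`normallyIsomorphic_of_hasCone`), so the two are normally isomorphic. Moreover a two-dimensional
face of the displacement contains a parallelogram with four lattice vertices, while a unimodular
triangle has only three lattice points (`isUTFree_firstDisplacement`).

For the converses, induct on the size of `S`. Let `v'` be the other endpoint of the edge at `v` with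
direction `w j`, where `j ∉ S`. The corners for `S` at `v` and `v'` lie in `P`, and differ by
`m • w j` with an integer `m ≥ 0`. If `m ≥ 1`, then the corner for `S ∪ {j}` lies in `P` by
convexity (`corner_mem_of_corner_ne`). Let `m = 0`. Then the displacement of the face with facets `S`
has a vertex where it should have an edge with direction `w j`, so that its normal fan differs from
that of the face (`corner_ne_of_normallyIsomorphic`). Also, for `s ∈ S` and `R = S \ {s}`, the
displacement of the face with facets `R` meets the plane through the corner for `R` spanned by `w j`
and `w s` in a face that is a triangle, with one leg `w s` because of the collapse; comparing with
the endpoint of the edge in direction `w s` shows that the other leg is `w j`, so that the triangle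
is unimodular (`corner_ne_of_isUTFree`).
-/

namespace LatticePolytope

variable {n : ℕ}

/-! ### Lattice vectors and the dot product -/

theorem toReal_dotProduct_toReal (u z : Fin n → ℤ) :
    toReal u ⬝ᵥ toReal z = ((u ⬝ᵥ z : ℤ) : ℝ) := by
  simp [toReal, dotProduct]

theorem toReal_add (u z : Fin n → ℤ) : toReal (u + z) = toReal u + toReal z := by
  ext; simp [toReal]

theorem toReal_sub (u z : Fin n → ℤ) : toReal (u - z) = toReal u - toReal z := by
  ext; simp [toReal]

theorem toReal_neg (u : Fin n → ℤ) : toReal (-u) = -toReal u := by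
  ext; simp [toReal]

theorem toReal_smul (m : ℤ) (u : Fin n → ℤ) : toReal (m • u) = (m : ℝ) • toReal u := by
  ext; simp [toReal]

theorem toReal_sum {ι : Type*} (s : Finset ι) (f : ι → Fin n → ℤ) :
    toReal (∑ i ∈ s, f i) = ∑ i ∈ s, toReal (f i) := by
  ext; simp [toReal]

theorem toReal_injective : Function.Injective (toReal (n := n)) := by
  intro u z h
  ext i
  have := congrFun h i
  simpa [toReal] using this

theorem isPrimitive_iff {u : Fin n → ℤ} :
    IsPrimitive u ↔ ∀ m : ℤ, (∀ i, m ∣ u i) → IsUnit m := by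
  refine ⟨fun h m hm => ?_, fun h => ?_⟩
  · have : m ∣ Finset.univ.gcd u := Finset.dvd_gcd fun i _ => hm i
    rw [h] at this
    exact isUnit_of_dvd_one this
  · rw [IsPrimitive, ← Finset.normalize_gcd]
    exact normalize_eq_one.2 (h _ fun i => Finset.gcd_dvd (Finset.mem_univ i))

theorem isPrimitive_of_dotProduct_eq_one {a w : Fin n → ℤ} (h : a ⬝ᵥ w = 1) : IsPrimitive a := by
  refine isPrimitive_iff.2 fun m hm => isUnit_of_dvd_one (h ▸ ?_)
  exact Finset.dvd_sum fun i _ => Dvd.dvd.mul_right (hm i) _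

theorem IsPrimitive.neg {a : Fin n → ℤ} (h : IsPrimitive a) : IsPrimitive (-a) := by
  rw [isPrimitive_iff] at *
  simpa using h

/-- Every nonzero lattice vector is a positive multiple of a primitive one. -/
theorem exists_isPrimitive_smul {u : Fin n → ℤ} (hu : u ≠ 0) :
    ∃ (g : ℤ) (p : Fin n → ℤ), 0 < g ∧ IsPrimitive p ∧ u = g • p := by
  obtain ⟨k, hk⟩ := Function.ne_iff.1 hu
  obtain ⟨p, hp, hg⟩ := Finset.extract_gcd u (s := Finset.univ) ⟨k, Finset.mem_univ k⟩
  refine ⟨Finset.univ.gcd u, p, ?_, hg, ?_⟩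
  · have h0 : 0 ≤ Finset.univ.gcd u := by
      rw [← Finset.normalize_gcd]; exact Int.nonneg_of_normalize_eq_self (by simp)
    refine lt_of_le_of_ne h0 fun h => hk ?_
    exact Finset.gcd_eq_zero_iff.1 h.symm k (Finset.mem_univ k)
  · ext i
    simpa using hp i (Finset.mem_univ i)

/-! ### Faces and vertices -/

theorem exists_strongDual_eq_dotProduct (c : Fin n → ℝ) :
    ∃ l : StrongDual ℝ (Fin n → ℝ), ∀ x, l x = c ⬝ᵥ x :=
  ⟨∑ i, c i • ContinuousLinearMap.proj i, fun x => by simp [dotProduct]⟩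

theorem exists_dotProduct_eq_strongDual (l : StrongDual ℝ (Fin n → ℝ)) :
    ∃ c : Fin n → ℝ, ∀ x, l x = c ⬝ᵥ x := by
  refine ⟨fun i => l (Pi.single i 1), fun x => ?_⟩
  have := LinearMap.pi_apply_eq_sum_univ (l : (Fin n → ℝ) →ₗ[ℝ] ℝ) x
  simp only [ContinuousLinearMap.coe_coe] at this
  rw [this, dotProduct]
  refine Finset.sum_congr rfl fun i _ => ?_
  rw [smul_eq_mul, mul_comm]
  congr 2
  ext j
  simp [Pi.single_apply, eq_comm]

theorem isFace_iff {P F : Set (Fin n → ℝ)} :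
    IsFace P F ↔ F.Nonempty ∧ ∃ c : Fin n → ℝ, F = {x | x ∈ P ∧ ∀ y ∈ P, c ⬝ᵥ y ≤ c ⬝ᵥ x} := by
  refine and_congr_right fun hF => ⟨fun h => ?_, ?_⟩
  · obtain ⟨l, hl⟩ := h hF
    obtain ⟨c, hc⟩ := exists_dotProduct_eq_strongDual l
    exact ⟨c, by simpa [hc] using hl⟩
  · rintro ⟨c, hc⟩ -
    obtain ⟨l, hl⟩ := exists_strongDual_eq_dotProduct c
    exact ⟨l, by simpa [hl] using hc⟩

theorem isFace_of_forall_le {P : Set (Fin n → ℝ)} {c v : Fin n → ℝ} (hv : v ∈ P)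
    (hc : ∀ y ∈ P, c ⬝ᵥ y ≤ c ⬝ᵥ v) : IsFace P {x | x ∈ P ∧ c ⬝ᵥ x = c ⬝ᵥ v} := by
  refine isFace_iff.2 ⟨⟨v, hv, rfl⟩, c, ?_⟩
  ext x
  exact and_congr_right fun hx => ⟨fun h y hy => h ▸ hc y hy, fun h => le_antisymm (hc x hx) (h v hv)⟩

theorem IsPolytope.isCompact {P : Set (Fin n → ℝ)} (h : IsPolytope P) : IsCompact P := by
  obtain ⟨s, hs, rfl⟩ := h
  exact hs.isCompact_convexHull ℝ

theorem IsPolytope.convex {P : Set (Fin n → ℝ)} (h : IsPolytope P) : Convex ℝ P := by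
  obtain ⟨s, hs, rfl⟩ := h
  exact convex_convexHull ℝ s

theorem IsVertex.mem {P : Set (Fin n → ℝ)} {v : Fin n → ℝ} (h : IsVertex P v) : v ∈ P :=
  h.2.subset rfl

/-- An extreme point of a polytope is not in the hull of the other generators, so it can be strictly
separated from them. -/
theorem IsPolytope.isVertex_of_mem_extremePoints {P : Set (Fin n → ℝ)} (h : IsPolytope P)
    {v : Fin n → ℝ} (hv : v ∈ P.extremePoints ℝ) : IsVertex P v := by
  have hP := h.convex
  obtain ⟨s, hs, rfl⟩ := h
  have hvs : v ∉ convexHull ℝ (s \ {v}) := fun hmem => by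
    have hc := (hP.mem_extremePoints_iff_convex_sdiff.1 hv).2
    have : convexHull ℝ (s \ {v}) ⊆ convexHull ℝ s \ {v} :=
      convexHull_min (Set.sdiff_subset_sdiff_left (subset_convexHull ℝ s)) hc
    exact (this hmem).2 rfl
  obtain ⟨f, r, hf, hr⟩ := geometric_hahn_banach_closed_point (convex_convexHull ℝ _)
    ((hs.sdiff (t := {v})).isCompact_convexHull ℝ).isClosed hvs
  have hle : ∀ y ∈ convexHull ℝ s, y ≠ v → f y < f v := fun y hy hyv => by
    by_cases hsv : (s \ {v}).Nonempty
    · have hy' : y ∈ convexHull ℝ (insert v (s \ {v})) :=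
        convexHull_mono (by intro z hz; by_cases h : z = v <;> simp [h, hz]) hy
      rw [convexHull_insert hsv, mem_convexJoin] at hy'
      obtain ⟨a, ha, b, hb, t₁, t₂, h₁, h₂, h₁₂, rfl⟩ := hy'
      rw [Set.mem_singleton_iff] at ha
      subst ha
      have ht₂ : 0 < t₂ := by
        refine lt_of_le_of_ne h₂ fun h0 => hyv ?_
        have : t₁ = 1 := by linarith
        simp [this, ← h0]
      have := (hf b hb).trans hr
      simp only [map_add, map_smul, smul_eq_mul]
      obtain rfl : t₁ = 1 - t₂ := by linarith
      nlinarith [mul_lt_mul_of_pos_left this ht₂]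
    · have hs' : s ⊆ {v} := by
        rw [Set.not_nonempty_iff_eq_empty, Set.sdiff_eq_empty] at hsv
        exact hsv
      have := convexHull_mono (𝕜 := ℝ) hs' hy
      simp at this
      exact absurd this hyv
  refine ⟨Set.singleton_nonempty v, fun _ => ⟨f, ?_⟩⟩
  ext x
  simp only [Set.mem_singleton_iff, Set.mem_ofPred_eq]
  refine ⟨?_, fun hx => ?_⟩
  · rintro rfl
    refine ⟨hv.1, fun y hy => ?_⟩
    by_cases hyx : y = x
    · rw [hyx]
    · exact (hle y hy hyx).le
  · by_contra hxv
    exact (hle x hx.1 hxv).not_ge (hx.2 v hv.1)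

theorem IsPolytope.exists_isVertex_maximizer {P F : Set (Fin n → ℝ)} (h : IsPolytope P)
    (hF : IsFace P F) (d : Fin n → ℝ) :
    ∃ v ∈ F, IsVertex P v ∧ ∀ y ∈ F, d ⬝ᵥ y ≤ d ⬝ᵥ v := by
  obtain ⟨l, hl⟩ := exists_strongDual_eq_dotProduct d
  have hFc : IsCompact F := hF.2.isCompact h.isCompact
  obtain ⟨x, hx, hmax⟩ := hFc.exists_isMaxOn hF.1 l.continuous.continuousOn
  have hG : IsExposed ℝ F (l.toExposed F) := ContinuousLinearMap.toExposed.isExposed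
  obtain ⟨v, hv⟩ := (hG.isCompact hFc).extremePoints_nonempty ⟨x, hx, hmax⟩
  have hv' := (hF.2.isExtreme.trans hG.isExtreme).extremePoints_subset_extremePoints hv
  have hvG := extremePoints_subset hv
  exact ⟨v, hvG.1, h.isVertex_of_mem_extremePoints hv', fun y hy => by
    simpa [hl] using hvG.2 y hy⟩

/-! ### A polytope lies in the cone spanned by its edges at a vertex -/

theorem IsVertex.exists_lt {P : Set (Fin n → ℝ)} {v : Fin n → ℝ} (h : IsVertex P v) :
    ∃ c : Fin n → ℝ, ∀ y ∈ P, y ≠ v → c ⬝ᵥ y < c ⬝ᵥ v := by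
  obtain ⟨c, hc⟩ := (isFace_iff.1 h).2
  have hv : v ∈ {x | x ∈ P ∧ ∀ y ∈ P, c ⬝ᵥ y ≤ c ⬝ᵥ x} := hc ▸ rfl
  refine ⟨c, fun y hy hyv => lt_of_le_of_ne (hv.2 y hy) fun he => hyv ?_⟩
  have : y ∈ {x | x ∈ P ∧ ∀ y ∈ P, c ⬝ᵥ y ≤ c ⬝ᵥ x} := ⟨hy, fun z hz => he ▸ hv.2 z hz⟩
  rw [← hc] at this
  exact this

/-- A face contained in a line through a vertex `v` is an edge with endpoint `v`. -/
theorem IsFace.exists_eq_segment {P e : Set (Fin n → ℝ)} (hP : IsPolytope P) (he : IsFace P e)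
    {v r : Fin n → ℝ} (hv : IsVertex P v) (hve : v ∈ e) (hr : r ≠ 0) (hre : v + r ∈ e)
    (hline : ∀ x ∈ e, ∃ τ : ℝ, x = v + τ • r) :
    ∃ T : ℝ, 0 < T ∧ e = segment ℝ v (v + T • r) := by
  obtain ⟨c, hc⟩ := hv.exists_lt
  obtain ⟨q, hq, -, hmax⟩ := hP.exists_isVertex_maximizer he (-c)
  obtain ⟨T, rfl⟩ := hline q hq
  have heP : e ⊆ P := he.2.subset
  have hcr : c ⬝ᵥ r < 0 := by
    have := hc _ (heP hre) (by simpa using hr)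
    rw [dotProduct_add] at this
    linarith
  have hmax' : ∀ τ : ℝ, v + τ • r ∈ e → τ ≤ T := fun τ hτ => by
    have := hmax _ hτ
    simp only [neg_dotProduct, dotProduct_add, dotProduct_smul, smul_eq_mul] at this
    nlinarith
  have hT : 1 ≤ T := hmax' 1 (by simpa using hre)
  refine ⟨T, by linarith, subset_antisymm (fun x hx => ?_) ?_⟩
  · obtain ⟨τ, rfl⟩ := hline x hx
    have h1 := hmax' τ hx
    have h0 : 0 ≤ τ := by
      by_contra hneg
      have := hc _ (heP hx) (by simp [hr, (not_le.1 hneg).ne])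
      simp only [dotProduct_add, dotProduct_smul, smul_eq_mul] at this
      nlinarith
    rw [segment_eq_image']
    refine ⟨τ / T, ⟨by positivity, (div_le_one (by linarith)).2 h1⟩, ?_⟩
    simp only [add_sub_cancel_left, smul_smul]
    rw [div_mul_cancel₀ _ (by linarith)]
  · exact (he.2.convex hP.convex).segment_subset hve hq

theorem vectorSpan_segment_add_smul {v r : Fin n → ℝ} {T : ℝ} (hT : T ≠ 0) :
    vectorSpan ℝ (segment ℝ v (v + T • r)) = Submodule.span ℝ {r} := by
  rw [← convexHull_pair, ← direction_affineSpan, affineSpan_convexHull, direction_affineSpan,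
    vectorSpan_pair]
  simp only [vsub_eq_sub, sub_add_cancel_left]
  rw [← Submodule.span_singleton_smul_eq (IsUnit.mk0 T hT) r]
  rw [← Set.neg_singleton, Submodule.span_neg]

theorem dim_segment_add_smul {v r : Fin n → ℝ} {T : ℝ} (hT : T ≠ 0) (hr : r ≠ 0) :
    dim (segment ℝ v (v + T • r)) = 1 := by
  rw [dim, vectorSpan_segment_add_smul hT, finrank_span_singleton hr]

/-- In a smooth polytope an edge direction at a vertex is a positive multiple of a primitive edge
vector. -/
theorem IsSmooth.exists_isPrimitiveEdgeVector {P e : Set (Fin n → ℝ)} (hP : IsSmooth P)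
    (he : IsFace P e) {v r : Fin n → ℝ} {T : ℝ} (hT : 0 < T) (hr : r ≠ 0)
    (hseg : e = segment ℝ v (v + T • r)) :
    ∃ (u : Fin n → ℤ) (κ : ℝ), 0 < κ ∧ r = κ • toReal u ∧ IsPrimitiveEdgeVector P v u := by
  have hdim : IsEdge P e := ⟨he, hseg ▸ dim_segment_add_smul hT.ne' hr⟩
  obtain ⟨u, hu, hspan⟩ := hP.rational e hdim
  rw [hseg, vectorSpan_segment_add_smul hT.ne'] at hspan
  obtain ⟨κ, hκ⟩ := Submodule.mem_span_singleton.1 (hspan ▸ Submodule.mem_span_singleton_self r)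
  obtain ⟨g, p, hg, hp, rfl⟩ := exists_isPrimitive_smul hu
  rw [toReal_smul, smul_smul] at hκ
  have key : ∀ (q : Fin n → ℤ) (m : ℝ), 0 < m → IsPrimitive q → m • toReal q = r →
      ∃ (u : Fin n → ℤ) (κ : ℝ), 0 < κ ∧ r = κ • toReal u ∧ IsPrimitiveEdgeVector P v u :=
    fun q m hm hq hqr => ⟨q, m, hm, hqr.symm, hq, T * m, by positivity, by
      rw [← smul_smul, hqr, ← hseg]; exact hdim⟩
  have hg' : (0 : ℝ) < g := by exact_mod_cast hg
  have hm0 : κ * g ≠ 0 := fun h0 => hr (by rw [← hκ, h0, zero_smul])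
  rcases lt_or_gt_of_ne hm0 with hlt | hgt
  · exact key (-p) (-(κ * g)) (by linarith) hp.neg (by rw [toReal_neg, smul_neg, neg_smul, neg_neg, hκ])
  · exact key p _ hgt hp hκ

/-- A functional that is negative on generators of a cone is negative on the cone away from `0`. -/
theorem lt_zero_or_eq_zero_of_mem_span {T : Set (Fin n → ℝ)} {f : StrongDual ℝ (Fin n → ℝ)}
    (hf : ∀ y ∈ T, f y < 0) {z : Fin n → ℝ} (hz : z ∈ Submodule.span NNReal T) :
    f z < 0 ∨ z = 0 := by
  induction hz using Submodule.span_induction with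
  | mem x hx => exact Or.inl (hf x hx)
  | zero => exact Or.inr rfl
  | add x y _ _ hx hy =>
    rcases hx with hx | rfl <;> rcases hy with hy | rfl <;> simp_all [add_neg]
  | smul a x _ hx =>
    rcases hx with hx | rfl
    · rcases eq_or_ne a 0 with rfl | ha
      · simp
      · left
        have : (0 : ℝ) < a := lt_of_le_of_ne a.2 (by exact_mod_cast ha.symm)
        rw [NNReal.smul_def, map_smul, smul_eq_mul]
        exact mul_neg_of_pos_of_neg this hx
    · simp

/-- The cone of a smooth polytope at a vertex is generated by the primitive edge vectors. Among the
subsets of the generators that still span the cone take a minimal one; each of its members spans a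
ray that a hyperplane separates from the rest of the cone, and so lies on an edge. -/
theorem IsSmooth.sub_mem_span {P : Set (Fin n → ℝ)} (hP : IsSmooth P) {v : Fin n → ℝ}
    (hv : IsVertex P v) {x : Fin n → ℝ} (hx : x ∈ P) :
    x - v ∈ Submodule.span NNReal (toReal '' {u | IsPrimitiveEdgeVector P v u}) := by
  classical
  obtain ⟨s, hs, hPs⟩ := hP.polytope
  obtain ⟨c, hc⟩ := hv.exists_lt
  have hsP : s ⊆ P := hPs ▸ subset_convexHull ℝ s
  let S : Set (Fin n → ℝ) := (fun y => y - v) '' (s \ {v})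
  have hS : S.Finite := hs.sdiff.image _
  have hfin : {T : Set (Fin n → ℝ) | T ⊆ S ∧ S ⊆ Submodule.span NNReal T}.Finite :=
    hS.finite_subsets.subset fun T hT => hT.1
  obtain ⟨T, hT, hmin⟩ := hfin.exists_minimal ⟨S, subset_rfl, Submodule.subset_span⟩
  have hTfin : T.Finite := hS.subset hT.1
  have hPT : ∀ y ∈ P, y - v ∈ Submodule.span NNReal T := by
    have hconv : Convex ℝ {y | y - v ∈ Submodule.span NNReal T} := by
      intro y hy z hz a b ha hb hab
      lift a to NNReal using ha
      lift b to NNReal using hb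
      have : (a : ℝ) • y + (b : ℝ) • z - v = a • (y - v) + b • (z - v) := by
        rw [NNReal.smul_def, NNReal.smul_def]
        have : (a : ℝ) • v + (b : ℝ) • v = v := by rw [← add_smul, hab, one_smul]
        rw [smul_sub, smul_sub, sub_add_sub_comm, this]
      rw [Set.mem_ofPred_eq, this]
      exact add_mem (Submodule.smul_mem _ _ hy) (Submodule.smul_mem _ _ hz)
    rw [hPs]
    refine fun y hy => convexHull_min (fun z hz => ?_) hconv hy
    by_cases hzv : z = v
    · simp [hzv]
    · exact hT.2 ⟨z, ⟨hz, hzv⟩, rfl⟩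
  have hcT : ∀ t ∈ T, c ⬝ᵥ t < 0 ∧ v + t ∈ P := fun t ht => by
    obtain ⟨y, hy, rfl⟩ := hT.1 ht
    have := hc y (hsP hy.1) hy.2
    simp only [dotProduct_sub, add_sub_cancel]
    exact ⟨by linarith, hsP hy.1⟩
  suffices hTe : T ⊆ Submodule.span NNReal (toReal '' {u | IsPrimitiveEdgeVector P v u}) from
    Submodule.span_le.2 hTe (hPT x hx)
  intro t ht
  have hnot : t ∉ Submodule.span NNReal (T \ {t}) := fun hmem => by
    have hle : Submodule.span NNReal T ≤ Submodule.span NNReal (T \ {t}) := by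
      refine Submodule.span_le.2 fun y hy => ?_
      by_cases hyt : y = t
      · rw [hyt]; exact hmem
      · exact Submodule.subset_span ⟨hy, hyt⟩
    have := hmin (y := T \ {t}) ⟨Set.sdiff_subset.trans hT.1, hT.2.trans hle⟩ Set.sdiff_subset ht
    exact this.2 rfl
  have hK : convexHull ℝ (T \ {t}) ⊆ Submodule.span NNReal (T \ {t}) := by
    refine convexHull_min Submodule.subset_span ?_
    intro y hy z hz a b ha hb hab
    exact add_mem (Submodule.smul_mem _ (⟨a, ha⟩ : NNReal) hy)
      (Submodule.smul_mem _ (⟨b, hb⟩ : NNReal) hz)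
  have hKc : ∀ y ∈ convexHull ℝ (T \ {t}), c ⬝ᵥ y < 0 := fun y hy => by
    obtain ⟨l, hl⟩ := exists_strongDual_eq_dotProduct c
    have := convexHull_min (s := T \ {t}) (t := {y | l y < 0})
      (fun y hy => by simpa [hl] using (hcT y hy.1).1)
      (convex_halfSpace_lt l.toLinearMap.isLinear 0) hy
    simpa [hl] using this
  have hdisj : Disjoint (convexHull ℝ (T \ {t})) (Submodule.span ℝ {t} : Set (Fin n → ℝ)) := by
    refine Set.disjoint_left.2 fun y hy hyt => ?_
    obtain ⟨μ, rfl⟩ := Submodule.mem_span_singleton.1 hyt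
    rcases lt_or_ge 0 μ with hμ | hμ
    · refine hnot ?_
      lift μ to NNReal using hμ.le
      have := Submodule.smul_mem _ μ⁻¹ (hK hy)
      rwa [← NNReal.smul_def, smul_smul, inv_mul_cancel₀ (by exact_mod_cast hμ.ne'), one_smul] at this
    · have := hKc _ hy
      rw [dotProduct_smul, smul_eq_mul] at this
      nlinarith [(hcT t ht).1]
  obtain ⟨f, p, q, hfp, hpq, hfq⟩ := geometric_hahn_banach_compact_closed
    (convex_convexHull ℝ _) (hTfin.sdiff.isCompact_convexHull ℝ) (Submodule.convex _)
    (Submodule.closed_of_finiteDimensional _) hdisj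
  have hq0 : q < 0 := by simpa using hfq 0 (zero_mem _)
  -- A functional bounded below on a line vanishes on it.
  have hft : f t = 0 := by
    by_contra hne
    have := hfq (((q - 1) / f t) • t) (Submodule.smul_mem _ _ (Submodule.mem_span_singleton_self t))
    rw [map_smul, smul_eq_mul, div_mul_cancel₀ _ hne] at this
    linarith
  have hfT : ∀ y ∈ T \ {t}, f y < 0 := fun y hy =>
    (hfp y (subset_convexHull ℝ _ hy)).trans (hpq.trans hq0)
  have hdec : ∀ y ∈ P, f y ≤ f v ∧ (f y = f v → ∃ τ : ℝ, y = v + τ • t) := fun y hy => by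
    have hyT := hPT y hy
    rw [← Set.insert_sdiff_self_of_mem ht, Submodule.mem_span_insert] at hyT
    obtain ⟨a, z, hz, hyz⟩ := hyT
    have hfy : f y = f v + f z := by
      rw [sub_eq_iff_eq_add.1 hyz, NNReal.smul_def, map_add, map_add, map_smul, hft]
      simp [add_comm]
    rcases lt_zero_or_eq_zero_of_mem_span hfT hz with h | rfl
    · exact ⟨by linarith, fun h' => absurd h' (by linarith)⟩
    · refine ⟨by simp [hfy], fun _ => ⟨a, ?_⟩⟩
      rw [sub_eq_iff_eq_add.1 hyz, NNReal.smul_def, add_zero, add_comm]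
  obtain ⟨d, hd⟩ := exists_dotProduct_eq_strongDual f
  have hface : IsFace P {y | y ∈ P ∧ d ⬝ᵥ y = d ⬝ᵥ v} :=
    isFace_of_forall_le hv.mem fun y hy => by rw [← hd, ← hd]; exact (hdec y hy).1
  have ht0 : t ≠ 0 := by
    rintro rfl
    simpa using (hcT 0 ht).1
  obtain ⟨L, hL, hseg⟩ := hface.exists_eq_segment hP.polytope hv ⟨hv.mem, rfl⟩ ht0
    ⟨(hcT t ht).2, by rw [← hd, ← hd, map_add, hft, add_zero]⟩
    fun y hy => (hdec y hy.1).2 (by rw [hd, hd]; exact hy.2)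
  obtain ⟨u, κ, hκ, hu, hue⟩ := hP.exists_isPrimitiveEdgeVector hface hL ht0 hseg
  rw [hu]
  exact Submodule.smul_mem _ (⟨κ, hκ.le⟩ : NNReal) (Submodule.subset_span ⟨u, hue, rfl⟩)

/-! ### Frames at the vertices of a smooth polytope -/

/-- A frame of `P` at a vertex `v`: the primitive edge vectors `w i` at `v`, numbered by `Fin n`,
with the dual integer vectors `a i`. The numbers `a i ⬝ (x - v)` are the coordinates of `x` in the
frame, and `P` lies in the orthant where they are nonnegative. So `-a i` are outer facet normals. -/
structure IsFrame (P : Set (Fin n → ℝ)) (v : Fin n → ℝ) (w a : Fin n → Fin n → ℤ) : Prop where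
  vertex : IsVertex P v
  range_eq : Set.range w = {u | IsPrimitiveEdgeVector P v u}
  dual : ∀ i j, a i ⬝ᵥ w j = if i = j then 1 else 0
  nonneg : ∀ x ∈ P, ∀ i, 0 ≤ toReal (a i) ⬝ᵥ (x - v)

theorem IsSmooth.exists_isFrame {P : Set (Fin n → ℝ)} (hP : IsSmooth P) {v : Fin n → ℝ}
    (hv : IsVertex P v) : ∃ w a, IsFrame P v w a := by
  obtain ⟨b, hb⟩ := hP.unimodular v hv
  have hdual : ∀ (i : Fin n) (z : Fin n → ℤ),
      (fun k => b.repr (Pi.single k 1) i) ⬝ᵥ z = b.repr z i := by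
    intro i z
    have := LinearMap.pi_apply_eq_sum_univ (b.coord i) z
    rw [← Module.Basis.coord_apply, this, dotProduct]
    refine Finset.sum_congr rfl fun k _ => ?_
    rw [smul_eq_mul, mul_comm, Module.Basis.coord_apply]
    congr 3
    ext j
    simp [Pi.single_apply, eq_comm]
  refine ⟨b, fun i k => b.repr (Pi.single k 1) i, hv, hb, fun i j => ?_, fun x hx i => ?_⟩
  · rw [hdual, b.repr_self, Finsupp.single_apply]
    simp [eq_comm]
  · have hmem := hP.sub_mem_span hv hx
    rw [← hb] at hmem
    generalize x - v = y at hmem ⊢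
    induction hmem using Submodule.span_induction with
    | mem y hy =>
      obtain ⟨_, ⟨j, rfl⟩, rfl⟩ := hy
      rw [toReal_dotProduct_toReal, hdual, b.repr_self, Finsupp.single_apply]
      split_ifs <;> simp
    | zero => simp
    | add y z _ _ hy hz => rw [dotProduct_add]; exact add_nonneg hy hz
    | smul r y _ hy =>
      rw [NNReal.smul_def, dotProduct_smul, smul_eq_mul]
      exact mul_nonneg r.2 hy

namespace IsFrame

variable {P : Set (Fin n → ℝ)} {v : Fin n → ℝ} {w a : Fin n → Fin n → ℤ}

theorem dual_real (h : IsFrame P v w a) (i j : Fin n) :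
    toReal (a i) ⬝ᵥ toReal (w j) = if i = j then 1 else 0 := by
  rw [toReal_dotProduct_toReal, h.dual]
  split_ifs <;> simp

theorem injective (h : IsFrame P v w a) : Function.Injective w := fun i j hij => by
  have := h.dual i j
  rw [← hij, h.dual] at this
  by_contra hne
  simp [hne] at this

theorem toReal_ne_zero (h : IsFrame P v w a) (i : Fin n) : toReal (w i) ≠ 0 := fun h0 => by
  have := h.dual_real i i
  simp [h0] at this

/-- Frames are bases, already over `ℤ`: a left inverse of a square matrix is a right inverse. -/
theorem eq_sum_int (h : IsFrame P v w a) (z : Fin n → ℤ) : z = ∑ i, (a i ⬝ᵥ z) • w i := by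
  have h1 : Matrix.of a * (Matrix.of w).transpose = 1 := by
    ext i j
    rw [Matrix.mul_apply', Matrix.one_apply]
    exact h.dual i j
  have h2 := mul_eq_one_comm.1 h1
  have h3 : ((Matrix.of w).transpose * Matrix.of a).mulVec z = z := by rw [h2, Matrix.one_mulVec]
  rw [← Matrix.mulVec_mulVec] at h3
  conv_lhs => rw [← h3]
  ext k
  simp [Matrix.mulVec, dotProduct, mul_comm]

theorem eq_sum (h : IsFrame P v w a) (y : Fin n → ℝ) :
    y = ∑ i, (toReal (a i) ⬝ᵥ y) • toReal (w i) := by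
  have key : ∀ k : Fin n, Pi.single k (1 : ℝ) =
      ∑ i, (toReal (a i) ⬝ᵥ Pi.single k (1 : ℝ)) • toReal (w i) := fun k => by
    have hk : toReal (Pi.single k 1) = Pi.single k (1 : ℝ) := by
      ext j
      simp only [toReal, Pi.single_apply]
      split_ifs <;> simp
    rw [← hk]
    conv_lhs => rw [h.eq_sum_int (Pi.single k 1), toReal_sum]
    simp only [toReal_smul, toReal_dotProduct_toReal]
  let L : (Fin n → ℝ) →ₗ[ℝ] (Fin n → ℝ) :=
    { toFun := fun y => ∑ i, (toReal (a i) ⬝ᵥ y) • toReal (w i)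
      map_add' := fun x y => by simp only [dotProduct_add, add_smul, Finset.sum_add_distrib]
      map_smul' := fun r x => by
        simp only [dotProduct_smul, smul_assoc, Finset.smul_sum, RingHom.id_apply] }
  have : L = LinearMap.id := by
    refine LinearMap.pi_ext' fun k => LinearMap.ext_ring ?_
    exact (key k).symm
  exact (LinearMap.congr_fun this y).symm

theorem ext (h : IsFrame P v w a) {x y : Fin n → ℝ}
    (hxy : ∀ i, toReal (a i) ⬝ᵥ x = toReal (a i) ⬝ᵥ y) : x = y := by
  rw [h.eq_sum x, h.eq_sum y]
  simp only [hxy]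

theorem eq_add_sum (h : IsFrame P v w a) (x : Fin n → ℝ) :
    x = v + ∑ i, (toReal (a i) ⬝ᵥ (x - v)) • toReal (w i) := by
  rw [← h.eq_sum, add_sub_cancel]

theorem exists_isEdge (h : IsFrame P v w a) (i : Fin n) :
    ∃ t : ℝ, 0 < t ∧ IsEdge P (segment ℝ v (v + t • toReal (w i))) :=
  (h.range_eq ▸ Set.mem_range_self i : w i ∈ {u | IsPrimitiveEdgeVector P v u}).2

theorem exists_mem (h : IsFrame P v w a) (i : Fin n) :
    ∃ t : ℝ, 0 < t ∧ v + t • toReal (w i) ∈ P := by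
  obtain ⟨t, ht, he⟩ := h.exists_isEdge i
  exact ⟨t, ht, he.1.2.subset (right_mem_segment ℝ _ _)⟩

theorem dotProduct_eq_sum (h : IsFrame P v w a) (c x : Fin n → ℝ) :
    c ⬝ᵥ x = c ⬝ᵥ v + ∑ i, (toReal (a i) ⬝ᵥ (x - v)) * (c ⬝ᵥ toReal (w i)) := by
  conv_lhs => rw [h.eq_add_sum x, dotProduct_add, dotProduct_sum]
  simp only [dotProduct_smul, smul_eq_mul]

/-- The `i`-th coordinate hyperplane of a frame cuts out a facet. -/
theorem isFacetInequality (h : IsFrame P v w a) (i : Fin n) :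
    IsFacetInequality P (-a i) (-(toReal (a i) ⬝ᵥ v)) := by
  have hle : ∀ x ∈ P, toReal (-a i) ⬝ᵥ x ≤ toReal (-a i) ⬝ᵥ v := fun x hx => by
    have := h.nonneg x hx i
    rw [dotProduct_sub] at this
    simp only [toReal_neg, neg_dotProduct]
    linarith
  have hv : -(toReal (a i) ⬝ᵥ v) = toReal (-a i) ⬝ᵥ v := by rw [toReal_neg, neg_dotProduct]
  rw [hv]
  refine ⟨(isPrimitive_of_dotProduct_eq_one (by rw [h.dual, if_pos rfl])).neg, hle,
    isFace_of_forall_le h.vertex.mem hle, ?_⟩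
  have hmem : v ∈ {x | x ∈ P ∧ toReal (-a i) ⬝ᵥ x = toReal (-a i) ⬝ᵥ v} := ⟨h.vertex.mem, rfl⟩
  have hspan : vectorSpan ℝ {x | x ∈ P ∧ toReal (-a i) ⬝ᵥ x = toReal (-a i) ⬝ᵥ v} =
      Submodule.span ℝ (Set.range fun j : {j // j ≠ i} => toReal (w j)) := by
    refine le_antisymm ?_ (Submodule.span_le.2 ?_)
    · rw [vectorSpan_eq_span_vsub_set_right ℝ hmem]
      refine Submodule.span_le.2 ?_
      rintro _ ⟨x, hx, rfl⟩
      have hxi : toReal (a i) ⬝ᵥ (x - v) = 0 := by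
        have := hx.2
        simp only [toReal_neg, neg_dotProduct] at this
        rw [dotProduct_sub]
        linarith
      change x - v ∈ Submodule.span ℝ _
      rw [h.eq_sum (x - v)]
      refine Submodule.sum_mem _ fun j _ => ?_
      by_cases hj : j = i
      · rw [hj, hxi, zero_smul]; exact zero_mem _
      · exact Submodule.smul_mem _ _ (Submodule.subset_span ⟨⟨j, hj⟩, rfl⟩)
    · rintro _ ⟨⟨j, hj⟩, rfl⟩
      obtain ⟨t, ht, htP⟩ := h.exists_mem j
      have := vsub_mem_vectorSpan ℝ (p₁ := v + t • toReal (w j)) (p₂ := v)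
        (s := {x | x ∈ P ∧ toReal (-a i) ⬝ᵥ x = toReal (-a i) ⬝ᵥ v})
        ⟨htP, by simp [toReal_neg, h.dual_real, Ne.symm hj]⟩ hmem
      simpa [ht.ne'] using Submodule.smul_mem _ t⁻¹ this
  have hli : LinearIndependent ℝ fun j : {j // j ≠ i} => toReal (w j) := by
    have : LinearIndependent ℝ fun j => toReal (w j) := by
      rw [Fintype.linearIndependent_iff]
      intro g hg j
      have := congrArg (toReal (a j) ⬝ᵥ ·) hg
      simpa [dotProduct_sum, h.dual_real] using this
    exact this.comp _ Subtype.val_injective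
  rw [dim, hspan, finrank_span_eq_card hli]
  have := i.pos
  simp
  omega

/-- A facet inequality that is tight at `v` belongs to a coordinate hyperplane of the frame: its
normal is nonpositive on the edge vectors, and for dimension reasons it vanishes on all but one. -/
theorem exists_eq_neg (h : IsFrame P v w a) {u : Fin n → ℤ} {b : ℝ} (hu : IsFacetInequality P u b)
    (hv : toReal u ⬝ᵥ v = b) : ∃ i, u = -a i := by
  classical
  obtain ⟨hprim, hle, -, hdim⟩ := hu
  have hw : ∀ j, u ⬝ᵥ w j ≤ 0 := fun j => by
    obtain ⟨t, ht, htP⟩ := h.exists_mem j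
    have := hle _ htP
    rw [dotProduct_add, hv, dotProduct_smul, toReal_dotProduct_toReal, smul_eq_mul] at this
    have : t * ((u ⬝ᵥ w j : ℤ) : ℝ) ≤ 0 := by linarith
    exact_mod_cast nonpos_of_mul_nonpos_right this ht
  let J : Finset (Fin n) := {j | u ⬝ᵥ w j = 0}
  have hspan : vectorSpan ℝ {x | x ∈ P ∧ toReal u ⬝ᵥ x = b} ≤
      Submodule.span ℝ (J.image fun j => toReal (w j) : Finset (Fin n → ℝ)) := by
    rw [vectorSpan_eq_span_vsub_set_right ℝ
      (show v ∈ {x | x ∈ P ∧ toReal u ⬝ᵥ x = b} from ⟨h.vertex.mem, hv⟩)]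
    refine Submodule.span_le.2 ?_
    rintro _ ⟨x, hx, rfl⟩
    have hsum := h.dotProduct_eq_sum (toReal u) x
    rw [hx.2, hv, left_eq_add, Finset.sum_eq_zero_iff_of_nonpos] at hsum
    · change x - v ∈ Submodule.span ℝ _
      rw [h.eq_sum (x - v)]
      refine Submodule.sum_mem _ fun j _ => ?_
      rcases mul_eq_zero.1 (hsum j (Finset.mem_univ j)) with h0 | h0
      · rw [h0, zero_smul]; exact zero_mem _
      · refine Submodule.smul_mem _ _ (Submodule.subset_span ?_)
        rw [toReal_dotProduct_toReal] at h0
        have : j ∈ J := by simpa [J] using h0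
        exact Finset.mem_coe.2 (Finset.mem_image_of_mem _ this)
    · intro j _
      refine mul_nonpos_of_nonneg_of_nonpos (h.nonneg x hx.1 j) ?_
      rw [toReal_dotProduct_toReal]
      exact_mod_cast hw j
  have hcard : n ≤ J.card + 1 := by
    have h1 := Submodule.finrank_mono hspan
    have h2 := finrank_span_finset_le_card (R := ℝ) (J.image fun j => toReal (w j))
    have h3 := J.card_image_le (f := fun j => toReal (w j))
    rw [dim] at hdim
    have h4 : (Set.finrank ℝ ((J.image fun j => toReal (w j) : Finset (Fin n → ℝ)) :
      Set (Fin n → ℝ))) ≤ _ := h2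
    rw [Set.finrank] at h4
    omega
  have hJc : (Jᶜ).card ≤ 1 := by
    rw [Finset.card_compl, Fintype.card_fin]
    omega
  have huexp : ∀ z : Fin n → ℤ, u ⬝ᵥ z = ∑ j, (a j ⬝ᵥ z) * (u ⬝ᵥ w j) := fun z => by
    conv_lhs => rw [h.eq_sum_int z, dotProduct_sum]
    simp only [dotProduct_smul, smul_eq_mul]
  obtain ⟨i, hi⟩ : ∃ i, u ⬝ᵥ w i ≠ 0 := by
    by_contra! hall
    have hu0 : ∀ k, u k = 0 := fun k => by
      have := huexp (Pi.single k 1)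
      simpa [hall] using this
    have := isPrimitive_iff.1 hprim 0 (by simp [hu0])
    simp at this
  have hother : ∀ j, j ≠ i → u ⬝ᵥ w j = 0 := fun j hji => by
    by_contra hj
    exact hji (Finset.card_le_one.1 hJc j (by simpa [J] using hj) i (by simpa [J] using hi))
  have huk : ∀ k, u k = (u ⬝ᵥ w i) * a i k := fun k => by
    have := huexp (Pi.single k 1)
    rw [Finset.sum_eq_single i (fun j _ hj => by rw [hother j hj, mul_zero]) (by simp)] at this
    simpa [mul_comm] using this
  have hunit := isPrimitive_iff.1 hprim (u ⬝ᵥ w i) fun k => ⟨_, huk k⟩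
  have hneg : u ⬝ᵥ w i = -1 := by
    rcases Int.isUnit_iff.1 hunit with h1 | h1
    · have := hw i; omega
    · exact h1
  exact ⟨i, by ext k; rw [huk k, hneg]; simp⟩

theorem firstDisplacement_eq (h : IsFrame P v w a) {F : Set (Fin n → ℝ)} (hvF : v ∈ F) :
    firstDisplacement P F = {x | x ∈ P ∧ ∀ i, (∀ y ∈ F, toReal (a i) ⬝ᵥ (y - v) = 0) →
      toReal (a i) ⬝ᵥ (x - v) = 1} := by
  ext x
  refine and_congr_right fun hx => ⟨fun H i hi => ?_, fun H u b hu hF => ?_⟩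
  · have := H (-a i) _ (h.isFacetInequality i) fun y hy => by
      have := hi y hy
      rw [dotProduct_sub] at this
      rw [toReal_neg, neg_dotProduct]
      linarith
    rw [toReal_neg, neg_dotProduct] at this
    rw [dotProduct_sub]
    linarith
  · obtain ⟨i, rfl⟩ := h.exists_eq_neg hu (hF v hvF)
    have hb := hF v hvF
    have := H i fun y hy => by
      have := hF y hy
      simp only [toReal_neg, neg_dotProduct] at this hb
      rw [dotProduct_sub]
      linarith
    rw [dotProduct_sub] at this
    simp only [toReal_neg, neg_dotProduct] at hb ⊢
    linarith

/-- Reordering the edge vectors of a frame. -/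
theorem reindex (h : IsFrame P v w a) (σ : Equiv.Perm (Fin n)) :
    IsFrame P v (w ∘ σ) (a ∘ σ) where
  vertex := h.vertex
  range_eq := by rw [σ.surjective.range_comp, h.range_eq]
  dual i j := by simp [h.dual]
  nonneg x hx i := h.nonneg x hx (σ i)

/-- Along the edge in direction `w j` lies an adjacent vertex. A frame there can be numbered so that
the facets that contain the edge keep their numbers. -/
theorem exists_adjacent (hP : IsSmooth P) (h : IsFrame P v w a) (j : Fin n) :
    ∃ (t : ℝ) (w' a' : Fin n → Fin n → ℤ), 0 < t ∧ IsFrame P (v + t • toReal (w j)) w' a' ∧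
      w' j = -w j ∧ ∀ i, i ≠ j → a' i = a i := by
  obtain ⟨t, ht, he⟩ := h.exists_isEdge j
  have hvert : IsVertex P (v + t • toReal (w j)) := by
    obtain ⟨q, hq, hqv, hmax⟩ := hP.polytope.exists_isVertex_maximizer he.1 (toReal (a j))
    have := hmax _ (right_mem_segment ℝ _ _)
    rw [segment_eq_image'] at hq
    obtain ⟨θ, ⟨-, hθ⟩, rfl⟩ := hq
    simp only [add_sub_cancel_left, smul_smul, dotProduct_add, dotProduct_smul, h.dual_real,
      if_true, smul_eq_mul, mul_one, add_le_add_iff_left] at this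
    have hθ1 : θ = 1 := by nlinarith
    simpa [hθ1] using hqv
  obtain ⟨w₁, a₁, h₁⟩ := hP.exists_isFrame hvert
  have hedge : -w j ∈ Set.range w₁ := by
    rw [h₁.range_eq]
    have hwj : w j ∈ {u | IsPrimitiveEdgeVector P v u} := h.range_eq ▸ Set.mem_range_self j
    refine ⟨hwj.1.neg, t, ht, ?_⟩
    rw [toReal_neg, smul_neg, add_neg_cancel_right, segment_symm]
    exact he
  obtain ⟨k, hk⟩ := hedge
  have hfacet : ∀ i, i ≠ j → ∃ l, a₁ l = a i := fun i hij => by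
    obtain ⟨l, hl⟩ := h₁.exists_eq_neg (h.isFacetInequality i) (by
      simp [toReal_neg, h.dual_real, hij])
    exact ⟨l, neg_injective hl.symm⟩
  choose! σ hσ using hfacet
  have ha : Function.Injective a := fun i i' hii => by
    have := h.dual i i'
    rw [hii, h.dual] at this
    by_contra hne
    simp [hne] at this
  have hinj : Function.Injective (Function.update σ j k) := by
    have hne : ∀ i, i ≠ j → σ i ≠ k := fun i hij hik => by
      have h1 := h₁.dual (σ i) k
      rw [hσ i hij, hk, dotProduct_neg, h.dual, if_neg hij, if_pos hik] at h1
      simp at h1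
    intro i i' hii
    by_cases hi : i = j <;> by_cases hi' : i' = j
    · rw [hi, hi']
    · subst hi
      simp only [Function.update_self, Function.update_of_ne hi'] at hii
      exact absurd hii.symm (hne i' hi')
    · subst hi'
      simp only [Function.update_self, Function.update_of_ne hi] at hii
      exact absurd hii (hne i hi)
    · rw [Function.update_of_ne hi, Function.update_of_ne hi'] at hii
      exact ha (by rw [← hσ i hi, ← hσ i' hi', hii])
  let π : Equiv.Perm (Fin n) := Equiv.ofBijective _ (Finite.injective_iff_bijective.1 hinj)
  refine ⟨t, w₁ ∘ π, a₁ ∘ π, ht, h₁.reindex π, ?_, fun i hij => ?_⟩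
  · simp [π, hk]
  · simp [π, Function.update_of_ne hij, hσ i hij]

end IsFrame

/-! ### Normal fans and local cones -/

/-- `A` lies in the cone `x + cone (w i | i ∈ I)` and contains `x` and some point on each ray that
spans it. If `A` is convex and the `w i` are linearly independent, then `A` coincides with this cone
near `x`. -/
structure HasCone (A : Set (Fin n → ℝ)) (x : Fin n → ℝ) (I : Set (Fin n))
    (w : Fin n → Fin n → ℝ) : Prop where
  mem : x ∈ A
  exists_mem : ∀ i ∈ I, ∃ t : ℝ, 0 < t ∧ x + t • w i ∈ A
  exists_eq : ∀ z ∈ A, ∃ c : Fin n → ℝ, (∀ i, 0 ≤ c i) ∧ (∀ i, i ∉ I → c i = 0) ∧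
    z = x + ∑ i, c i • w i

namespace HasCone

variable {A : Set (Fin n → ℝ)} {x : Fin n → ℝ} {I : Set (Fin n)} {w : Fin n → Fin n → ℝ}

theorem forall_le_iff (h : HasCone A x I w) (d : Fin n → ℝ) :
    (∀ z ∈ A, d ⬝ᵥ z ≤ d ⬝ᵥ x) ↔ ∀ i ∈ I, d ⬝ᵥ w i ≤ 0 := by
  refine ⟨fun H i hi => ?_, fun H z hz => ?_⟩
  · obtain ⟨t, ht, htA⟩ := h.exists_mem i hi
    have := H _ htA
    rw [dotProduct_add, dotProduct_smul, smul_eq_mul] at this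
    exact nonpos_of_mul_nonpos_right (by linarith) ht
  · obtain ⟨c, hc, hc0, rfl⟩ := h.exists_eq z hz
    rw [dotProduct_add, dotProduct_sum, add_le_iff_nonpos_right]
    refine Finset.sum_nonpos fun i _ => ?_
    rw [dotProduct_smul, smul_eq_mul]
    by_cases hi : i ∈ I
    · exact mul_nonpos_of_nonneg_of_nonpos (hc i) (H i hi)
    · rw [hc0 i hi, zero_mul]

/-- A maximizer of `d` has nonzero coordinates only along edge vectors orthogonal to `d`. -/
theorem mul_eq_zero_of_maximizer (h : HasCone A x I w) {d : Fin n → ℝ}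
    (hx : ∀ z ∈ A, d ⬝ᵥ z ≤ d ⬝ᵥ x) {c : Fin n → ℝ} (hc : ∀ i, 0 ≤ c i)
    (hc0 : ∀ i, i ∉ I → c i = 0) (hz : d ⬝ᵥ x ≤ d ⬝ᵥ (x + ∑ i, c i • w i)) (i : Fin n) :
    c i * (d ⬝ᵥ w i) = 0 := by
  rw [dotProduct_add, dotProduct_sum, le_add_iff_nonneg_right] at hz
  simp only [dotProduct_smul, smul_eq_mul] at hz
  have hle : ∀ i ∈ Finset.univ, c i * (d ⬝ᵥ w i) ≤ 0 := fun i _ => by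
    by_cases hi : i ∈ I
    · exact mul_nonpos_of_nonneg_of_nonpos (hc i) ((h.forall_le_iff d).1 hx i hi)
    · rw [hc0 i hi, zero_mul]
  exact (Finset.sum_eq_zero_iff_of_nonpos hle).1 (le_antisymm (Finset.sum_nonpos hle) hz) i
    (Finset.mem_univ i)

/-- The normal cone at the face of maximizers of `d` depends only on the cone at a maximizer. -/
theorem mem_normalCone_iff (h : HasCone A x I w) {d : Fin n → ℝ}
    (hx : ∀ z ∈ A, d ⬝ᵥ z ≤ d ⬝ᵥ x) (e : Fin n → ℝ) :
    e ∈ normalCone A {z | z ∈ A ∧ ∀ y ∈ A, d ⬝ᵥ y ≤ d ⬝ᵥ z} ↔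
      ∀ i ∈ I, e ⬝ᵥ w i ≤ 0 ∧ (d ⬝ᵥ w i = 0 → e ⬝ᵥ w i = 0) := by
  refine ⟨fun H i hi => ?_, fun H z hz y hy => ?_⟩
  · have hex := H x ⟨h.mem, hx⟩
    refine ⟨(h.forall_le_iff e).1 hex i hi, fun hdi => ?_⟩
    obtain ⟨t, ht, htA⟩ := h.exists_mem i hi
    have h1 := H (x + t • w i) ⟨htA, fun y hy => by
      simpa [dotProduct_add, hdi] using hx y hy⟩ x h.mem
    have h2 := hex _ htA
    simp only [dotProduct_add, dotProduct_smul, smul_eq_mul] at h1 h2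
    have : t * (e ⬝ᵥ w i) = 0 := by linarith
    exact (mul_eq_zero.1 this).resolve_left ht.ne'
  · have hey := (h.forall_le_iff e).2 (fun i hi => (H i hi).1) y hy
    obtain ⟨c, hc, hc0, rfl⟩ := h.exists_eq z hz.1
    have hz0 := h.mul_eq_zero_of_maximizer hx hc hc0 (hz.2 x h.mem)
    have : ∑ i, e ⬝ᵥ (c i • w i) = 0 := Finset.sum_eq_zero fun i _ => by
      rw [dotProduct_smul, smul_eq_mul]
      by_cases hi : i ∈ I
      · rcases mul_eq_zero.1 (hz0 i) with h0 | h0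
        · rw [h0, zero_mul]
        · rw [(H i hi).2 h0, mul_zero]
      · rw [hc0 i hi, zero_mul]
    rw [dotProduct_add, dotProduct_sum, this, add_zero]
    exact hey

end HasCone

/-- Two sets are normally isomorphic when every functional has maximizers over both of them at which
they have the same local cone. -/
theorem normallyIsomorphic_of_hasCone {A B : Set (Fin n → ℝ)}
    (H : ∀ d : Fin n → ℝ, ∃ x y I w, HasCone A x I w ∧ HasCone B y I w ∧
      ∀ z ∈ A, d ⬝ᵥ z ≤ d ⬝ᵥ x) : NormallyIsomorphic A B := by
  have key : ∀ d : Fin n → ℝ, ({z | z ∈ A ∧ ∀ y ∈ A, d ⬝ᵥ y ≤ d ⬝ᵥ z} : Set _).Nonempty ∧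
      ({z | z ∈ B ∧ ∀ y ∈ B, d ⬝ᵥ y ≤ d ⬝ᵥ z} : Set _).Nonempty ∧
      normalCone A {z | z ∈ A ∧ ∀ y ∈ A, d ⬝ᵥ y ≤ d ⬝ᵥ z} =
        normalCone B {z | z ∈ B ∧ ∀ y ∈ B, d ⬝ᵥ y ≤ d ⬝ᵥ z} := fun d => by
    obtain ⟨x, y, I, w, hA, hB, hx⟩ := H d
    have hy := (hB.forall_le_iff d).2 ((hA.forall_le_iff d).1 hx)
    exact ⟨⟨x, hA.mem, hx⟩, ⟨y, hB.mem, hy⟩, Set.ext fun e => by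
      rw [hA.mem_normalCone_iff hx, hB.mem_normalCone_iff hy]⟩
  ext C
  constructor
  · rintro ⟨F, hF, rfl⟩
    obtain ⟨-, d, rfl⟩ := isFace_iff.1 hF
    exact ⟨_, isFace_iff.2 ⟨(key d).2.1, d, rfl⟩, (key d).2.2⟩
  · rintro ⟨F, hF, rfl⟩
    obtain ⟨-, d, rfl⟩ := isFace_iff.1 hF
    exact ⟨_, isFace_iff.2 ⟨(key d).1, d, rfl⟩, (key d).2.2.symm⟩

/-! ### Corners of the parallelepipeds -/

/-- The corner `v + ∑ i ∈ S, w i` of the parallelepiped spanned at `v` by the vectors `w i`. -/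
def corner (v : Fin n → ℝ) (w : Fin n → Fin n → ℤ) (S : Finset (Fin n)) : Fin n → ℝ :=
  v + ∑ i ∈ S, toReal (w i)

theorem corner_empty (v : Fin n → ℝ) (w : Fin n → Fin n → ℤ) : corner v w ∅ = v := by
  simp [corner]

theorem corner_insert (v : Fin n → ℝ) (w : Fin n → Fin n → ℤ) {S : Finset (Fin n)} {j : Fin n}
    (hj : j ∉ S) : corner v w (insert j S) = corner v w S + toReal (w j) := by
  rw [corner, corner, Finset.sum_insert hj, add_assoc, add_comm (toReal (w j))]

theorem exists_corner_eq_toReal {v : Fin n → ℝ} (hv : ∃ z : Fin n → ℤ, v = toReal z)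
    (w : Fin n → Fin n → ℤ) (S : Finset (Fin n)) : ∃ z : Fin n → ℤ, corner v w S = toReal z := by
  obtain ⟨z, rfl⟩ := hv
  exact ⟨z + ∑ i ∈ S, w i, by rw [corner, toReal_add, toReal_sum]⟩

namespace IsFrame

variable {P : Set (Fin n → ℝ)} {v : Fin n → ℝ} {w a : Fin n → Fin n → ℤ}

theorem dotProduct_corner_sub (h : IsFrame P v w a) (S : Finset (Fin n)) (k : Fin n) :
    toReal (a k) ⬝ᵥ (corner v w S - v) = if k ∈ S then 1 else 0 := by
  rw [corner, add_sub_cancel_left, dotProduct_sum]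
  simp [h.dual_real]

/-- The intersection of `P` with some of the facets through `v` is a face. -/
theorem isFace (h : IsFrame P v w a) (S : Finset (Fin n)) :
    IsFace P {x | x ∈ P ∧ ∀ i ∈ S, toReal (a i) ⬝ᵥ (x - v) = 0} := by
  have hsum : ∀ x, (-∑ i ∈ S, toReal (a i)) ⬝ᵥ x =
      (-∑ i ∈ S, toReal (a i)) ⬝ᵥ v - ∑ i ∈ S, toReal (a i) ⬝ᵥ (x - v) := fun x => by
    simp only [neg_dotProduct, sum_dotProduct, dotProduct_sub, Finset.sum_sub_distrib]
    ring
  have hface := isFace_of_forall_le (c := -∑ i ∈ S, toReal (a i)) h.vertex.mem fun y hy => by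
    rw [hsum y]
    have := Finset.sum_nonneg fun i (_ : i ∈ S) => h.nonneg y hy i
    linarith
  convert hface using 1
  ext x
  refine and_congr_right fun hx => ?_
  rw [hsum x, sub_eq_self, Finset.sum_eq_zero_iff_of_nonneg fun i _ => h.nonneg x hx i]

theorem firstDisplacement_isFace (h : IsFrame P v w a) (S : Finset (Fin n)) :
    firstDisplacement P {x | x ∈ P ∧ ∀ i ∈ S, toReal (a i) ⬝ᵥ (x - v) = 0} =
      {x | x ∈ P ∧ ∀ i ∈ S, toReal (a i) ⬝ᵥ (x - v) = 1} := by
  have hv : v ∈ {x | x ∈ P ∧ ∀ i ∈ S, toReal (a i) ⬝ᵥ (x - v) = 0} := ⟨h.vertex.mem, by simp⟩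
  rw [h.firstDisplacement_eq hv]
  ext x
  refine and_congr_right fun _ => forall_congr' fun i => imp_congr_left ⟨fun H => ?_, fun hi y hy => hy.2 i hi⟩
  by_contra hi
  obtain ⟨t, ht, htP⟩ := h.exists_mem i
  have := H _ ⟨htP, fun k hk => by
    have hki : k ≠ i := fun hki => hi (hki ▸ hk)
    simp [h.dual_real, hki]⟩
  simp [h.dual_real, ht.ne'] at this

/-- Every face through `v` is an intersection of facets through `v`. -/
theorem exists_eq_of_isFace (h : IsFrame P v w a) {F : Set (Fin n → ℝ)} (hF : IsFace P F)
    (hvF : v ∈ F) :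
    ∃ R : Finset (Fin n), F = {x | x ∈ P ∧ ∀ i ∈ R, toReal (a i) ⬝ᵥ (x - v) = 0} := by
  classical
  obtain ⟨-, c, rfl⟩ := isFace_iff.1 hF
  have hle : ∀ i, c ⬝ᵥ toReal (w i) ≤ 0 := fun i => by
    obtain ⟨t, ht, htP⟩ := h.exists_mem i
    have := hvF.2 _ htP
    rw [dotProduct_add, dotProduct_smul, smul_eq_mul] at this
    exact nonpos_of_mul_nonpos_right (by linarith) ht
  refine ⟨Finset.univ.filter fun i => c ⬝ᵥ toReal (w i) ≠ 0, Set.ext fun x => and_congr_right fun hx => ?_⟩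
  have hterm : ∀ i ∈ Finset.univ, (toReal (a i) ⬝ᵥ (x - v)) * (c ⬝ᵥ toReal (w i)) ≤ 0 :=
    fun i _ => mul_nonpos_of_nonneg_of_nonpos (h.nonneg x hx i) (hle i)
  have hsum := h.dotProduct_eq_sum c x
  constructor
  · intro H i hi
    have h0 : ∑ i, (toReal (a i) ⬝ᵥ (x - v)) * (c ⬝ᵥ toReal (w i)) = 0 :=
      le_antisymm (Finset.sum_nonpos hterm) (by linarith [H v h.vertex.mem])
    exact (mul_eq_zero.1 ((Finset.sum_eq_zero_iff_of_nonpos hterm).1 h0 i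
      (Finset.mem_univ i))).resolve_right (by simpa using hi)
  · intro H y hy
    have h0 : ∑ i, (toReal (a i) ⬝ᵥ (x - v)) * (c ⬝ᵥ toReal (w i)) = 0 :=
      Finset.sum_eq_zero fun i _ => by
        by_cases hi : c ⬝ᵥ toReal (w i) = 0
        · rw [hi, mul_zero]
        · rw [H i (by simpa using hi), zero_mul]
    rw [hsum, h0, add_zero]
    exact hvF.2 y hy

theorem hasCone_face (h : IsFrame P v w a) (R : Finset (Fin n)) :
    HasCone {x | x ∈ P ∧ ∀ i ∈ R, toReal (a i) ⬝ᵥ (x - v) = 0} v {i | i ∉ R}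
      fun i => toReal (w i) where
  mem := ⟨h.vertex.mem, by simp⟩
  exists_mem i hi := by
    obtain ⟨t, ht, htP⟩ := h.exists_mem i
    refine ⟨t, ht, htP, fun k hk => ?_⟩
    have hki : k ≠ i := fun hki => hi (hki ▸ hk)
    simp [h.dual_real, hki]
  exists_eq z hz := ⟨_, h.nonneg z hz.1, fun i hi => hz.2 i (by simpa using hi), h.eq_add_sum z⟩

/-- If all corners at `v` belong to `P`, then a face and its first displacement have the same local
cones at `v` and at the corresponding corner. -/
theorem hasCone_displacement (h : IsFrame P v w a) (hcorner : ∀ S, corner v w S ∈ P)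
    (R : Finset (Fin n)) :
    HasCone {x | x ∈ P ∧ ∀ i ∈ R, toReal (a i) ⬝ᵥ (x - v) = 1} (corner v w R) {i | i ∉ R}
      fun i => toReal (w i) where
  mem := ⟨hcorner R, fun i hi => by rw [h.dotProduct_corner_sub, if_pos hi]⟩
  exists_mem i hi := by
    refine ⟨1, one_pos, ?_, fun k hk => ?_⟩
    · rw [one_smul, ← corner_insert v w hi]
      exact hcorner _
    · rw [one_smul, ← corner_insert v w hi, h.dotProduct_corner_sub,
        if_pos (Finset.mem_insert_of_mem hk)]
  exists_eq z hz := by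
    refine ⟨fun i => if i ∈ R then 0 else toReal (a i) ⬝ᵥ (z - v), fun i => ?_, fun i hi => ?_, ?_⟩
    · dsimp only
      split_ifs
      · exact le_rfl
      · exact h.nonneg z hz.1 i
    · exact if_pos (by simpa using hi)
    · conv_lhs => rw [h.eq_add_sum z]
      rw [corner, add_assoc, ← Finset.sum_filter_add_sum_filter_not Finset.univ (· ∈ R)]
      congr 2
      · rw [Finset.filter_univ_mem]
        exact Finset.sum_congr rfl fun i hi => by rw [hz.2 i hi, one_smul]
      · rw [Finset.sum_filter]
        refine Finset.sum_congr rfl fun i _ => ?_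
        split_ifs <;> simp_all

end IsFrame

/-- A convex set contains a parallelepiped as soon as it contains its corners. -/
theorem cornerParallelepiped_subset {P : Set (Fin n → ℝ)} (hP : Convex ℝ P) {v : Fin n → ℝ}
    {w : Fin n → Fin n → ℤ} (hcorner : ∀ S, corner v w S ∈ P) : cornerParallelepiped v w ⊆ P := by
  have key : ∀ (A : Finset (Fin n)) (c : Fin n → ℝ), (∀ i, c i ∈ Set.Icc (0 : ℝ) 1) →
      (∀ i, i ∉ A → c i = 0 ∨ c i = 1) → v + ∑ i, c i • toReal (w i) ∈ P := by
    classical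
    intro A
    induction A using Finset.induction_on with
    | empty =>
      intro c _ h01
      convert hcorner {i | c i = 1} using 1
      rw [corner, Finset.sum_filter]
      congr 1
      refine Finset.sum_congr rfl fun i _ => ?_
      rcases h01 i (Finset.notMem_empty i) with h0 | h0 <;> simp [h0]
    | insert j A hj ih =>
      intro c hc h01
      have hupd : ∀ r : ℝ, r = 0 ∨ r = 1 →
          v + ∑ i, Function.update c j r i • toReal (w i) ∈ P := fun r hr => by
        refine ih _ (fun i => ?_) fun i hi => ?_
        · by_cases hij : i = j
          · subst hij
            rcases hr with rfl | rfl <;> simp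
          · rw [Function.update_of_ne hij]; exact hc i
        · by_cases hij : i = j
          · subst hij
            simpa using hr
          · rw [Function.update_of_ne hij]
            exact h01 i (by simp [hij, hi])
      have hsplit : ∀ r : ℝ, v + ∑ i, Function.update c j r i • toReal (w i) =
          v + ∑ i ∈ Finset.univ.erase j, c i • toReal (w i) + r • toReal (w j) := fun r => by
        rw [← Finset.sum_erase_add _ _ (Finset.mem_univ j), Function.update_self, add_assoc]
        congr 2
        exact Finset.sum_congr rfl fun i hi => by
          rw [Function.update_of_ne (Finset.ne_of_mem_erase hi)]
      have h0 := hupd 0 (Or.inl rfl)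
      have h1 := hupd 1 (Or.inr rfl)
      have := hP h0 h1 (sub_nonneg.2 (hc j).2) (hc j).1 (by ring)
      convert this using 1
      have hcj := hsplit (c j)
      rw [Function.update_eq_self] at hcj
      rw [hcj, hsplit, hsplit]
      module
  rintro _ ⟨c, hc, rfl⟩
  exact key Finset.univ c hc (by simp)

/-- Deep smoothness says that the corners of the parallelepipeds at the vertices lie in `P`. -/
theorem isDeeplySmooth_iff {P : Set (Fin n → ℝ)} (hP : IsSmooth P) (hL : IsLattice P) :
    IsDeeplySmooth P ↔ ∀ v w a, IsFrame P v w a → ∀ S, corner v w S ∈ P := by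
  classical
  refine ⟨fun h v w a hf S => ?_, fun H => ⟨hP, hL, fun v hv => ?_⟩⟩
  · obtain ⟨u, hu, hrange, hsub⟩ := h.corner v hf.vertex
    have huw : ∀ i, ∃ k, w k = u i := fun i => by
      have : u i ∈ Set.range w := by rw [hf.range_eq, ← hrange]; exact Set.mem_range_self i
      exact this
    choose σ hσ using huw
    have hσi : Function.Injective σ := fun i j hij => hu (by rw [← hσ i, hij, hσ j])
    refine hsub ⟨fun i => if σ i ∈ S then 1 else 0, fun i => ?_, ?_⟩
    · dsimp only
      split_ifs <;> simp
    · rw [corner]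
      congr 1
      have hσb := Finite.injective_iff_bijective.1 hσi
      have := hσb.sum_comp fun k => (if k ∈ S then (1 : ℝ) else 0) • toReal (w k)
      simp only [hσ] at this
      rw [this]
      simp
  · obtain ⟨w, a, hf⟩ := hP.exists_isFrame hv
    exact ⟨w, hf.injective, hf.range_eq, cornerParallelepiped_subset hP.polytope.convex (H v w a hf)⟩

/-! ### Consequences of deep smoothness -/

theorem normallyIsomorphic_firstDisplacement {P : Set (Fin n → ℝ)} (hP : IsSmooth P)
    (hcorner : ∀ v w a, IsFrame P v w a → ∀ S, corner v w S ∈ P) {F : Set (Fin n → ℝ)}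
    (hF : IsFace P F) : NormallyIsomorphic (firstDisplacement P F) F := by
  refine Eq.symm (normallyIsomorphic_of_hasCone fun d => ?_)
  obtain ⟨v, hvF, hv, hmax⟩ := hP.polytope.exists_isVertex_maximizer hF d
  obtain ⟨w, a, hf⟩ := hP.exists_isFrame hv
  obtain ⟨R, rfl⟩ := hf.exists_eq_of_isFace hF hvF
  rw [hf.firstDisplacement_isFace R]
  exact ⟨_, _, _, _, hf.hasCone_face R, hf.hasCone_displacement (hcorner v w a hf) R, hmax⟩

/-- The only lattice points of a unimodular triangle are its vertices. -/
theorem IsUnimodularTriangle.exists_forall_eq {T : Set (Fin n → ℝ)} (hT : IsUnimodularTriangle T)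
    (hdim : dim T = 2) :
    ∃ p q r : Fin n → ℤ, ∀ z : Fin n → ℤ, toReal z ∈ T → z = p ∨ z = q ∨ z = r := by
  obtain ⟨p, q, r, rfl, -, hspan⟩ := hT
  refine ⟨p, q, r, fun z hz => ?_⟩
  have hli : LinearIndependent ℝ ![toReal (q - p), toReal (r - p)] := by
    rw [linearIndependent_iff_card_le_finrank_span, Fintype.card_fin]
    refine hdim.ge.trans ?_
    rw [dim, ← direction_affineSpan, affineSpan_convexHull, direction_affineSpan,
      vectorSpan_eq_span_vsub_set_right ℝ (Set.mem_insert (toReal p) _)]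
    refine Submodule.finrank_mono (Submodule.span_le.2 ?_)
    rintro _ ⟨x, hx, rfl⟩
    rcases hx with rfl | rfl | rfl
    · simp
    · exact Submodule.subset_span ⟨0, by simp [toReal_sub]⟩
    · exact Submodule.subset_span ⟨1, by simp [toReal_sub]⟩
  rw [convexHull_insert (by simp), mem_convexJoin] at hz
  obtain ⟨_, rfl, y, hy, hz⟩ := hz
  rw [convexHull_pair] at hy
  obtain ⟨α, β, hα, hβ, hαβ, rfl⟩ := hy
  obtain ⟨γ, δ, hγ, hδ, hγδ, hz⟩ := hz
  have hz' : toReal (z - p) = (δ * α) • toReal (q - p) + (δ * β) • toReal (r - p) := by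
    rw [toReal_sub, toReal_sub, toReal_sub, ← hz]
    obtain rfl : γ = 1 - δ := by linarith
    obtain rfl : α = 1 - β := by linarith
    module
  obtain ⟨k, l, hkl⟩ := Submodule.mem_span_pair.1
    (hspan (z - p) (Submodule.mem_span_pair.2 ⟨_, _, hz'.symm⟩))
  rw [← hkl, toReal_add, toReal_smul, toReal_smul] at hz'
  obtain ⟨hk, hl⟩ := LinearIndependent.pair_iffₛ.1 hli _ _ _ _ hz'
  have hk0 : 0 ≤ k := by exact_mod_cast hk ▸ mul_nonneg hδ hα
  have hl0 : 0 ≤ l := by exact_mod_cast hl ▸ mul_nonneg hδ hβ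
  have hkl1 : k + l ≤ 1 := by
    have : (k : ℝ) + l ≤ 1 := by rw [hk, hl, ← mul_add, hαβ]; linarith
    exact_mod_cast this
  have hcase : (k = 0 ∧ l = 0) ∨ (k = 1 ∧ l = 0) ∨ (k = 0 ∧ l = 1) := by omega
  rcases hcase with ⟨rfl, rfl⟩ | ⟨rfl, rfl⟩ | ⟨rfl, rfl⟩
  · exact Or.inl (sub_eq_zero.1 (by simpa using hkl.symm))
  · exact Or.inr (Or.inl (by simpa using hkl.symm))
  · exact Or.inr (Or.inr (by simpa using hkl.symm))

/-- If `P` contains all corners, a two-dimensional face of a first displacement contains the four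
corners of a parallelogram, whereas a unimodular triangle has only three lattice points. -/
theorem isUTFree_firstDisplacement {P : Set (Fin n → ℝ)} (hP : IsSmooth P) (hL : IsLattice P)
    (hcorner : ∀ v w a, IsFrame P v w a → ∀ S, corner v w S ∈ P) {F : Set (Fin n → ℝ)}
    (hF : IsFace P F) : IsUTFree (firstDisplacement P F) := by
  intro T hT hdim hUT
  obtain ⟨p, q, r, hpqr⟩ := hUT.exists_forall_eq hdim
  obtain ⟨-, d, rfl⟩ := isFace_iff.1 hT
  obtain ⟨v, hvF, hv, hmax⟩ := hP.polytope.exists_isVertex_maximizer hF d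
  obtain ⟨w, a, hf⟩ := hP.exists_isFrame hv
  obtain ⟨R, rfl⟩ := hf.exists_eq_of_isFace hF hvF
  rw [hf.firstDisplacement_isFace R] at *
  set Q : Set (Fin n → ℝ) := {x | x ∈ P ∧ ∀ i ∈ R, toReal (a i) ⬝ᵥ (x - v) = 1}
  have hc := hf.hasCone_displacement (hcorner v w a hf) R
  have hx := (hc.forall_le_iff d).2 (((hf.hasCone_face R).forall_le_iff d).1 hmax)
  let J : Finset (Fin n) := Finset.univ.filter fun i => i ∉ R ∧ d ⬝ᵥ toReal (w i) = 0
  have hxT : corner v w R ∈ {z | z ∈ Q ∧ ∀ y ∈ Q, d ⬝ᵥ y ≤ d ⬝ᵥ z} := ⟨hc.mem, hx⟩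
  have hspan : vectorSpan ℝ {z | z ∈ Q ∧ ∀ y ∈ Q, d ⬝ᵥ y ≤ d ⬝ᵥ z} ≤
      Submodule.span ℝ (J.image fun j => toReal (w j) : Finset (Fin n → ℝ)) := by
    rw [vectorSpan_eq_span_vsub_set_right ℝ hxT]
    refine Submodule.span_le.2 ?_
    rintro _ ⟨z, hz, rfl⟩
    obtain ⟨c, hc0, hcR, rfl⟩ := hc.exists_eq z hz.1
    have hz0 := hc.mul_eq_zero_of_maximizer hx hc0 hcR (hz.2 _ hc.mem)
    simp only [vsub_eq_sub, add_sub_cancel_left]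
    refine Submodule.sum_mem _ fun i _ => ?_
    by_cases hi : i ∈ J
    · exact Submodule.smul_mem _ _ (Submodule.subset_span
        (Finset.mem_coe.2 (Finset.mem_image_of_mem _ hi)))
    · have : c i = 0 := by
        by_cases hiR : i ∈ R
        · exact hcR i (by simpa using hiR)
        · exact (mul_eq_zero.1 (hz0 i)).resolve_right fun h0 => hi (by simp [J, hiR, h0])
      rw [this, zero_smul]
      exact zero_mem _
  have hcard : 1 < J.card := by
    have h1 := Submodule.finrank_mono hspan
    have h2 : Module.finrank ℝ (Submodule.span ℝ
      ((J.image fun j => toReal (w j) : Finset (Fin n → ℝ)) : Set (Fin n → ℝ))) ≤ _ :=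
      finrank_span_finset_le_card (R := ℝ) (J.image fun j => toReal (w j))
    have h3 := J.card_image_le (f := fun j => toReal (w j))
    rw [dim] at hdim
    omega
  obtain ⟨i, hi, j, hj, hij⟩ := Finset.one_lt_card.1 hcard
  simp only [J, Finset.mem_filter, Finset.mem_univ, true_and] at hi hj
  have hlat : ∀ S, ∃ z, corner v w S = toReal z :=
    exists_corner_eq_toReal (hL.vertices v hv) w
  choose z hz using hlat
  have hmem : ∀ S, R ⊆ S → d ⬝ᵥ corner v w S = d ⬝ᵥ corner v w R →
      z S = p ∨ z S = q ∨ z S = r := fun S hS hd => hpqr _ (by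
    rw [← hz S]
    refine ⟨⟨hcorner v w a hf S, fun k hk => ?_⟩, fun y hy => hd ▸ hx y hy⟩
    rw [hf.dotProduct_corner_sub, if_pos (hS hk)])
  have hzinj : ∀ S S', z S = z S' → S = S' := fun S S' h => by
    ext k
    have hk := hf.dotProduct_corner_sub S k
    rw [hz S, h, ← hz S', hf.dotProduct_corner_sub S' k] at hk
    split_ifs at hk <;> simp_all
  have hjR : j ∉ insert i R := by simp [hij.symm, hj.1]
  have h0 := hmem R subset_rfl rfl
  have h1 := hmem (insert i R) (Finset.subset_insert _ _) (by
    rw [corner_insert v w hi.1, dotProduct_add, hi.2, add_zero])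
  have h2 := hmem (insert j R) (Finset.subset_insert _ _) (by
    rw [corner_insert v w hj.1, dotProduct_add, hj.2, add_zero])
  have h3 := hmem (insert j (insert i R))
    ((Finset.subset_insert _ _).trans (Finset.subset_insert _ _)) (by
    rw [corner_insert v w hjR, corner_insert v w hi.1, dotProduct_add, dotProduct_add, hi.2, hj.2,
      add_zero, add_zero])
  have n01 : z R ≠ z (insert i R) := fun h => hi.1 (by rw [hzinj _ _ h]; simp)
  have n02 : z R ≠ z (insert j R) := fun h => hj.1 (by rw [hzinj _ _ h]; simp)
  have n03 : z R ≠ z (insert j (insert i R)) := fun h => hj.1 (by rw [hzinj _ _ h]; simp)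
  have n12 : z (insert i R) ≠ z (insert j R) := fun h => hjR (by rw [hzinj _ _ h]; simp)
  have n13 : z (insert i R) ≠ z (insert j (insert i R)) := fun h =>
    hjR (by rw [hzinj _ _ h]; simp)
  have n23 : z (insert j R) ≠ z (insert j (insert i R)) := fun h => by
    have : i ∈ insert j R := by rw [hzinj _ _ h]; simp
    simp [hij, hi.1] at this
  grind

theorem firstDisplacement_self {P : Set (Fin n → ℝ)} (hP : IsSmooth P) {v : Fin n → ℝ}
    (hv : IsVertex P v) : IsFace P P ∧ firstDisplacement P P = P := by
  obtain ⟨w, a, hf⟩ := hP.exists_isFrame hv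
  have h1 := hf.isFace ∅
  have h2 := hf.firstDisplacement_isFace ∅
  simp only [Finset.notMem_empty, false_imp_iff, implies_true, and_true, Set.ofPred_mem_eq] at h1 h2
  exact ⟨h1, h2⟩

/-! ### Comparing corners along an edge -/

/-- Frames at the two endpoints `v` and `v'` of an edge with direction `w j`, numbered so that each
facet containing the edge has the same number at both endpoints. -/
structure AreAdjacentFrames (P : Set (Fin n → ℝ)) (v : Fin n → ℝ) (w a : Fin n → Fin n → ℤ)
    (j : Fin n) (v' : Fin n → ℝ) (w' a' : Fin n → Fin n → ℤ) : Prop where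
  left : IsFrame P v w a
  right : IsFrame P v' w' a'
  exists_eq : ∃ t : ℝ, 0 < t ∧ v' = v + t • toReal (w j)
  neg : w' j = -w j
  normal_eq : ∀ i, i ≠ j → a' i = a i

namespace AreAdjacentFrames

variable {P : Set (Fin n → ℝ)} {v v' : Fin n → ℝ} {w a w' a' : Fin n → Fin n → ℤ} {j : Fin n}

theorem dotProduct_sub_eq (h : AreAdjacentFrames P v w a j v' w' a') {i : Fin n} (hi : i ≠ j)
    (x : Fin n → ℝ) : toReal (a' i) ⬝ᵥ (x - v') = toReal (a i) ⬝ᵥ (x - v) := by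
  obtain ⟨t, -, rfl⟩ := h.exists_eq
  rw [h.normal_eq i hi, ← sub_sub, dotProduct_sub _ (x - v), dotProduct_smul, h.left.dual_real,
    if_neg hi, smul_zero, sub_zero]

theorem dotProduct_right (h : AreAdjacentFrames P v w a j v' w' a') :
    toReal (a' j) ⬝ᵥ toReal (w j) = -1 := by
  have := h.right.dual_real j j
  rw [h.neg, toReal_neg, dotProduct_neg, if_pos rfl] at this
  linarith

/-- Corresponding corners at adjacent vertices differ by an integer multiple of the edge vector. -/
theorem exists_corner_eq (h : AreAdjacentFrames P v w a j v' w' a') (hL : IsLattice P)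
    (S : Finset (Fin n)) :
    ∃ m : ℤ, corner v' w' S = corner v w S + (m : ℝ) • toReal (w j) := by
  obtain ⟨z, hz⟩ := exists_corner_eq_toReal (hL.vertices v h.left.vertex) w S
  obtain ⟨z', hz'⟩ := exists_corner_eq_toReal (hL.vertices v' h.right.vertex) w' S
  refine ⟨a j ⬝ᵥ (z' - z), h.left.ext fun i => ?_⟩
  rw [dotProduct_add, dotProduct_smul, h.left.dual_real]
  by_cases hi : i = j
  · rw [if_pos hi, hi, ← toReal_dotProduct_toReal, toReal_sub, hz, hz', dotProduct_sub, smul_eq_mul]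
    ring
  · have h1 := h.right.dotProduct_corner_sub S i
    rw [h.dotProduct_sub_eq hi, ← h.left.dotProduct_corner_sub S i, dotProduct_sub,
      dotProduct_sub] at h1
    rw [if_neg hi, smul_zero, add_zero]
    linarith

/-- The ray from a corner in direction `w j` leaves `P` at the corresponding corner at the adjacent
vertex, or before it. -/
theorem le_of_mem (h : AreAdjacentFrames P v w a j v' w' a') {S : Finset (Fin n)} (hj : j ∉ S)
    {m τ : ℝ} (hm : corner v' w' S = corner v w S + m • toReal (w j))
    (hτ : corner v w S + τ • toReal (w j) ∈ P) : τ ≤ m := by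
  have h1 := h.right.nonneg _ hτ j
  have h2 := h.right.dotProduct_corner_sub S j
  rw [hm] at h2
  simp only [dotProduct_sub, dotProduct_add, dotProduct_smul, h.dotProduct_right, smul_eq_mul,
    if_neg hj] at h1 h2
  linarith

end AreAdjacentFrames

theorem IsFrame.exists_areAdjacentFrames {P : Set (Fin n → ℝ)} {v : Fin n → ℝ}
    {w a : Fin n → Fin n → ℤ} (h : IsFrame P v w a) (hP : IsSmooth P) (j : Fin n) :
    ∃ v' w' a', AreAdjacentFrames P v w a j v' w' a' := by
  obtain ⟨t, w', a', ht, h', hneg, heq⟩ := h.exists_adjacent hP j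
  exact ⟨_, w', a', h, h', ⟨t, ht, rfl⟩, hneg, heq⟩

/-- All corners belong to `P` unless, at a smallest corner set that fails, the corners at two
adjacent vertices collapse. -/
theorem corner_mem_of_corner_ne {P : Set (Fin n → ℝ)} (hP : IsSmooth P) (hL : IsLattice P)
    (hne : ∀ v w a j v' w' a' S, AreAdjacentFrames P v w a j v' w' a' → j ∉ S → S.Nonempty →
      (∀ v w a, IsFrame P v w a → ∀ S' : Finset (Fin n), S'.card ≤ S.card → corner v w S' ∈ P) →
      corner v' w' S ≠ corner v w S) :
    ∀ v w a, IsFrame P v w a → ∀ S, corner v w S ∈ P := by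
  classical
  suffices H : ∀ (k : ℕ) v w a, IsFrame P v w a → ∀ S, S.card ≤ k → corner v w S ∈ P from
    fun v w a h S => H _ v w a h S le_rfl
  intro k
  induction k with
  | zero =>
    intro v w a h S hS
    rw [Finset.card_eq_zero.1 (Nat.le_zero.1 hS), corner_empty]
    exact h.vertex.mem
  | succ k ih =>
    intro v w a h S hS
    rcases S.eq_empty_or_nonempty with rfl | ⟨j, hj⟩
    · rw [corner_empty]
      exact h.vertex.mem
    obtain ⟨R, hjR, rfl⟩ : ∃ R, j ∉ R ∧ S = insert j R :=
      ⟨S.erase j, Finset.notMem_erase j S, (Finset.insert_erase hj).symm⟩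
    rw [Finset.card_insert_of_notMem hjR] at hS
    have hRk : R.card ≤ k := by omega
    obtain ⟨v', w', a', hadj⟩ := h.exists_areAdjacentFrames hP j
    obtain ⟨m, hm⟩ := hadj.exists_corner_eq hL R
    have hR := ih v w a h R hRk
    have hR' := ih v' w' a' hadj.right R hRk
    have hm0 : (0 : ℝ) ≤ m := hadj.le_of_mem hjR hm (by simpa using hR)
    have hm1 : m ≠ 0 := fun h0 => by
      rcases R.eq_empty_or_nonempty with rfl | hne'
      · obtain ⟨t, ht, rfl⟩ := hadj.exists_eq
        simp [corner_empty, h0, ht.ne', h.toReal_ne_zero] at hm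
      · exact hne v w a j v' w' a' R hadj hjR hne'
          (fun v w a h S' hS' => ih v w a h S' (hS'.trans hRk)) (by simpa [h0] using hm)
    have hm2 : (1 : ℝ) ≤ m := by
      have : 0 ≤ m := by exact_mod_cast hm0
      exact_mod_cast (show 1 ≤ m by omega)
    rw [corner_insert v w hjR]
    have := hP.polytope.convex hR hR' (a := 1 - (m : ℝ)⁻¹) (b := (m : ℝ)⁻¹)
      (sub_nonneg.2 (inv_le_one_of_one_le₀ hm2)) (by positivity) (by ring)
    convert this using 1
    rw [hm, smul_add, smul_smul, inv_mul_cancel₀ (by positivity)]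
    module

/-- In the displacement of a face the corner is as close as possible to every facet at `v`. -/
theorem IsFrame.dotProduct_corner_sub_le {P : Set (Fin n → ℝ)} {v : Fin n → ℝ}
    {w a : Fin n → Fin n → ℤ} (h : IsFrame P v w a) {R : Finset (Fin n)} {x : Fin n → ℝ}
    (hx : x ∈ P) (hR : ∀ i ∈ R, toReal (a i) ⬝ᵥ (x - v) = 1) (i : Fin n) :
    toReal (a i) ⬝ᵥ (corner v w R - v) ≤ toReal (a i) ⬝ᵥ (x - v) := by
  rw [h.dotProduct_corner_sub]
  split_ifs with hi
  · exact (hR i hi).ge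
  · exact h.nonneg x hx i

/-- A point of `P` in the displacement of a face that is at most as far from the facets numbered by
`D` as the corner is, has the same distances to these facets as the corner. -/
theorem IsFrame.eq_of_sum_le {P : Set (Fin n → ℝ)} {v : Fin n → ℝ} {w a : Fin n → Fin n → ℤ}
    (h : IsFrame P v w a) {R : Finset (Fin n)} {x : Fin n → ℝ} (hx : x ∈ P)
    (hR : ∀ i ∈ R, toReal (a i) ⬝ᵥ (x - v) = 1) {D : Finset (Fin n)}
    (hle : (-∑ i ∈ D, toReal (a i)) ⬝ᵥ corner v w R ≤ (-∑ i ∈ D, toReal (a i)) ⬝ᵥ x) :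
    ∀ i ∈ D, toReal (a i) ⬝ᵥ (x - v) = if i ∈ R then 1 else 0 := by
  have hterm := fun i (_ : i ∈ D) => h.dotProduct_corner_sub_le hx hR i
  have hsum : ∑ i ∈ D, toReal (a i) ⬝ᵥ (x - v) ≤ ∑ i ∈ D, toReal (a i) ⬝ᵥ (corner v w R - v) := by
    simp only [neg_dotProduct, sum_dotProduct] at hle
    simp only [dotProduct_sub, Finset.sum_sub_distrib]
    linarith
  have heq := (Finset.sum_eq_sum_iff_of_le hterm).1 (le_antisymm (Finset.sum_le_sum hterm) hsum)
  exact fun i hi => by rw [← heq i hi, h.dotProduct_corner_sub]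

theorem IsFrame.sum_le {P : Set (Fin n → ℝ)} {v : Fin n → ℝ} {w a : Fin n → Fin n → ℤ}
    (h : IsFrame P v w a) {R : Finset (Fin n)} {x : Fin n → ℝ} (hx : x ∈ P)
    (hR : ∀ i ∈ R, toReal (a i) ⬝ᵥ (x - v) = 1) (D : Finset (Fin n)) :
    (-∑ i ∈ D, toReal (a i)) ⬝ᵥ x ≤ (-∑ i ∈ D, toReal (a i)) ⬝ᵥ corner v w R := by
  have hterm := fun i (_ : i ∈ D) => h.dotProduct_corner_sub_le hx hR i
  have hsum := Finset.sum_le_sum hterm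
  simp only [dotProduct_sub, Finset.sum_sub_distrib] at hsum
  simp only [neg_dotProduct, sum_dotProduct]
  linarith

/-! ### Collapsing corners and normal fans -/

/-- If corners at the endpoints of an edge `e` of `F` collapse, the displacement of `F` has a vertex
where the edge parallel to `e` should be. -/
theorem corner_ne_of_normallyIsomorphic {P : Set (Fin n → ℝ)}
    (hN : ∀ F, IsFace P F → NormallyIsomorphic (firstDisplacement P F) F)
    {v v' : Fin n → ℝ} {w a w' a' : Fin n → Fin n → ℤ} {j : Fin n} {S : Finset (Fin n)}
    (h : AreAdjacentFrames P v w a j v' w' a') (hj : j ∉ S) (hS : corner v w S ∈ P) :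
    corner v' w' S ≠ corner v w S := by
  classical
  intro heq
  have hf := h.left
  have hfan := hN _ (hf.isFace S)
  rw [hf.firstDisplacement_isFace S] at hfan
  set F : Set (Fin n → ℝ) := {x | x ∈ P ∧ ∀ i ∈ S, toReal (a i) ⬝ᵥ (x - v) = 0}
  set Q : Set (Fin n → ℝ) := {x | x ∈ P ∧ ∀ i ∈ S, toReal (a i) ⬝ᵥ (x - v) = 1}
  have hvF : v ∈ F := ⟨hf.vertex.mem, by simp⟩
  have hSQ : corner v w S ∈ Q := ⟨hS, fun i hi => by rw [hf.dotProduct_corner_sub, if_pos hi]⟩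
  -- The functional `d` exposes the edge from `v` to `v'`, as a face of `F`.
  let d : Fin n → ℝ := -∑ i ∈ Finset.univ.erase j, toReal (a i)
  have hdF : ∀ x ∈ F, d ⬝ᵥ x ≤ d ⬝ᵥ v := fun x hx => by
    have := hf.sum_le (R := ∅) hx.1 (by simp) (Finset.univ.erase j)
    rwa [corner_empty] at this
  have hmem : normalCone F {x | x ∈ F ∧ d ⬝ᵥ x = d ⬝ᵥ v} ∈ normalFan F :=
    ⟨_, isFace_of_forall_le hvF hdF, rfl⟩
  rw [← show normalFan Q = normalFan F from hfan] at hmem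
  obtain ⟨B, hB, hFB⟩ := hmem
  have hd : d ∈ normalCone Q B := by
    rw [← hFB]
    intro x hx y hy
    rw [hx.2]
    exact hdF y hy
  have hBeq : ∀ b ∈ B, b = corner v w S := fun b hb => by
    have hbQ : b ∈ Q := hB.2.subset hb
    have hcoord := hf.eq_of_sum_le hbQ.1 hbQ.2 (hd b hb _ hSQ)
    have hbw : b = corner v w S + (toReal (a j) ⬝ᵥ (b - v)) • toReal (w j) := by
      rw [← sub_left_inj (a := v), add_sub_right_comm]
      refine hf.ext fun i => ?_
      rw [dotProduct_add, hf.dotProduct_corner_sub, dotProduct_smul, hf.dual_real]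
      by_cases hi : i = j
      · simp [hi, hj]
      · simp [hi, hcoord i (by simp [hi])]
    have h0 : toReal (a j) ⬝ᵥ (b - v) ≤ 0 :=
      h.le_of_mem hj (m := 0) (by simpa using heq) (hbw ▸ hbQ.1)
    rw [le_antisymm h0 (hf.nonneg b hbQ.1 j), zero_smul, add_zero] at hbw
    exact hbw
  have hneg : -toReal (a j) ∈ normalCone Q B := fun b hb y hy => by
    have h1 := hf.nonneg y hy.1 j
    have h2 := hf.dotProduct_corner_sub S j
    rw [if_neg hj] at h2
    rw [hBeq b hb]
    simp only [neg_dotProduct, dotProduct_sub] at *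
    linarith
  rw [← hFB] at hneg
  obtain ⟨t, ht, rfl⟩ := h.exists_eq
  have hv' := h.right.vertex.mem
  have hdw : d ⬝ᵥ toReal (w j) = 0 := by
    simp only [d, neg_dotProduct, sum_dotProduct, neg_eq_zero]
    refine Finset.sum_eq_zero fun i hi => ?_
    rw [hf.dual_real, if_neg (Finset.ne_of_mem_erase hi)]
  have := hneg (v + t • toReal (w j)) ⟨⟨hv', fun i hi => by
    have : i ≠ j := fun hij => hj (hij ▸ hi)
    simp [hf.dual_real, this]⟩, by simp [dotProduct_add, hdw]⟩ v hvF
  simp only [neg_dotProduct, dotProduct_add, dotProduct_smul, hf.dual_real, if_true, smul_eq_mul]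
    at this
  linarith

/-! ### Collapsing corners and unimodular triangles -/

/-- Two edge vectors of a frame, attached to a lattice point, span a unimodular triangle. -/
theorem IsFrame.isUnimodularTriangle {P : Set (Fin n → ℝ)} {v : Fin n → ℝ}
    {w a : Fin n → Fin n → ℤ} (h : IsFrame P v w a) {j s : Fin n} (hjs : j ≠ s)
    {V : Fin n → ℝ} (hV : ∃ z : Fin n → ℤ, V = toReal z) :
    dim (convexHull ℝ {V, V + toReal (w j), V + toReal (w s)}) = 2 ∧
      IsUnimodularTriangle (convexHull ℝ {V, V + toReal (w j), V + toReal (w s)}) := by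
  constructor
  · have hli : LinearIndependent ℝ ![toReal (w j), toReal (w s)] := by
      refine LinearIndependent.pair_iff.2 fun x y hxy => ?_
      have hj := congrArg (toReal (a j) ⬝ᵥ ·) hxy
      have hs := congrArg (toReal (a s) ⬝ᵥ ·) hxy
      simp only [dotProduct_add, dotProduct_smul, h.dual_real, hjs, hjs.symm] at hj hs
      simpa using And.intro hj hs
    have := finrank_span_eq_card hli
    rw [dim, ← direction_affineSpan, affineSpan_convexHull, direction_affineSpan,
      vectorSpan_eq_span_vsub_set_right ℝ (Set.mem_insert V _),
      Set.image_insert_eq, Set.image_insert_eq, Set.image_singleton]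
    have hset : ({V -ᵥ V, V + toReal (w j) -ᵥ V, V + toReal (w s) -ᵥ V} : Set (Fin n → ℝ)) =
        insert 0 (Set.range ![toReal (w j), toReal (w s)]) := by
      ext x
      simp [Matrix.range_cons, or_comm]
    rw [hset, Submodule.span_insert_zero, this, Fintype.card_fin]
  · obtain ⟨z, rfl⟩ := hV
    refine ⟨z, z + w j, z + w s, by rw [toReal_add, toReal_add], ?_, fun y hy => ?_⟩
    · rw [add_sub_cancel_left, add_sub_cancel_left]
      refine LinearIndependent.pair_iff.2 fun x y hxy => ?_
      have hj := congrArg (a j ⬝ᵥ ·) hxy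
      have hs := congrArg (a s ⬝ᵥ ·) hxy
      simp only [dotProduct_add, dotProduct_smul, h.dual, hjs, hjs.symm] at hj hs
      simpa using And.intro hj hs
    · rw [add_sub_cancel_left, add_sub_cancel_left] at *
      obtain ⟨α, β, hαβ⟩ := Submodule.mem_span_pair.1 hy
      have hj := congrArg (toReal (a j) ⬝ᵥ ·) hαβ
      have hs := congrArg (toReal (a s) ⬝ᵥ ·) hαβ
      simp only [dotProduct_add, dotProduct_smul, h.dual_real, hjs, hjs.symm,
        toReal_dotProduct_toReal] at hj hs
      refine Submodule.mem_span_pair.2 ⟨a j ⬝ᵥ y, a s ⬝ᵥ y, toReal_injective ?_⟩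
      rw [toReal_add, toReal_smul, toReal_smul, ← hj, ← hs, ← hαβ]
      simp

/-- If corners at two adjacent vertices collapse for a smallest set `S`, and `s ∈ S`, then the first
displacement of the face with facets `S \ {s}` has a unimodular triangle as a face. -/
theorem corner_ne_of_isUTFree {P : Set (Fin n → ℝ)} (hP : IsSmooth P) (hL : IsLattice P)
    (hU : ∀ F, IsFace P F → IsUTFree (firstDisplacement P F))
    {v v' : Fin n → ℝ} {w a w' a' : Fin n → Fin n → ℤ} {j : Fin n} {S : Finset (Fin n)}
    (h : AreAdjacentFrames P v w a j v' w' a') (hjS : j ∉ S) (hne : S.Nonempty)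
    (ih : ∀ v w a, IsFrame P v w a → ∀ S' : Finset (Fin n), S'.card ≤ S.card → corner v w S' ∈ P) :
    corner v' w' S ≠ corner v w S := by
  classical
  obtain ⟨s, hs⟩ := hne
  obtain ⟨R, hsR, rfl⟩ : ∃ R, s ∉ R ∧ S = insert s R :=
    ⟨S.erase s, Finset.notMem_erase s S, (Finset.insert_erase hs).symm⟩
  intro heq
  have hf := h.left
  have hjR : j ∉ R := fun hj => hjS (Finset.mem_insert_of_mem hj)
  have hjs : j ≠ s := fun hjs => hjS (hjs ▸ Finset.mem_insert_self s R)
  have hsjR : s ∉ insert j R := by simp [hjs.symm, hsR]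
  have hcard : (insert s R).card = R.card + 1 := Finset.card_insert_of_notMem hsR
  have hcardj : (insert j R).card = R.card + 1 := Finset.card_insert_of_notMem hjR
  obtain ⟨v'', w'', a'', h''⟩ := hf.exists_areAdjacentFrames hP s
  obtain ⟨m₁, hm₁⟩ := h.exists_corner_eq hL R
  obtain ⟨m₂, hm₂⟩ := h''.exists_corner_eq hL R
  obtain ⟨m₃, hm₃⟩ := h''.exists_corner_eq hL (insert j R)
  have hV := ih v w a hf R (by omega)
  have hVY := ih v w a hf (insert s R) le_rfl
  have hVX := ih v w a hf (insert j R) (by omega)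
  have hV' := ih v' w' a' h.right R (by omega)
  have hV'' := ih v'' w'' a'' h''.right R (by omega)
  have hVX'' := ih v'' w'' a'' h''.right (insert j R) (by omega)
  -- In the coordinates of the plane through `corner v w R` spanned by `w j` and `w s`, the
  -- polytope contains `(m₁, 0)`, `(0, m₂)` and `(1, m₃)`, besides `(0, 0)`, `(1, 0)` and `(0, 1)`.
  have hm₁_ge : (1 : ℝ) ≤ m₁ := h.le_of_mem hjR hm₁ (by
    rw [one_smul, ← corner_insert v w hjR]; exact hVX)
  have hm₂_ge : (1 : ℝ) ≤ m₂ := h''.le_of_mem hsR hm₂ (by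
    rw [one_smul, ← corner_insert v w hsR]; exact hVY)
  have hm₃_ge : (0 : ℝ) ≤ m₃ := h''.le_of_mem hsjR hm₃ (by simpa using hVX)
  -- The facet at `v'` opposite to `v` has the equation `x + m₁ y = m₁`, because it passes through
  -- `(m₁, 0)` and, by the collapse, through `(0, 1)`.
  have f₁ := h.right.dotProduct_corner_sub R j
  have f₂ := h.right.dotProduct_corner_sub (insert s R) j
  have f₃ := h.right.nonneg _ hV'' j
  have f₄ := h.right.nonneg _ hVX'' j
  rw [if_neg hjR, hm₁] at f₁
  rw [if_neg hjS, heq, corner_insert v w hsR] at f₂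
  rw [hm₂] at f₃
  rw [hm₃, corner_insert v w hjR] at f₄
  simp only [dotProduct_sub, dotProduct_add, dotProduct_smul, h.dotProduct_right, smul_eq_mul]
    at f₁ f₂ f₃ f₄
  have hY : toReal (a' j) ⬝ᵥ toReal (w s) = -m₁ := by linarith
  rw [hY] at f₂ f₃ f₄
  have hm₂_eq : (m₂ : ℝ) = 1 := by nlinarith
  have hm₃_eq : (m₃ : ℝ) = 0 := by
    have h1 : (m₃ : ℝ) < 1 := by nlinarith
    have h2 : m₃ < 1 := by exact_mod_cast h1
    have h3 : 0 ≤ m₃ := by exact_mod_cast hm₃_ge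
    have : m₃ = 0 := by omega
    simp [this]
  -- The facet at `v''` opposite to `v` passes through `(0, 1)` and `(1, 0)`.
  have g₁ := h''.right.dotProduct_corner_sub R s
  have g₂ := h''.right.dotProduct_corner_sub (insert j R) s
  have g₃ := h''.right.nonneg _ hV' s
  rw [if_neg hsR, hm₂] at g₁
  rw [if_neg hsjR, hm₃, corner_insert v w hjR] at g₂
  rw [hm₁] at g₃
  simp only [dotProduct_sub, dotProduct_add, dotProduct_smul, h''.dotProduct_right, smul_eq_mul,
    hm₂_eq, hm₃_eq] at g₁ g₂ g₃
  have hX : toReal (a'' s) ⬝ᵥ toReal (w j) = -1 := by linarith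
  rw [hX] at g₃
  have hm₁_eq : (m₁ : ℝ) = 1 := by linarith
  rw [hm₁_eq] at f₁ hY
  -- Hence the slice of the polytope by this plane is a unimodular triangle.
  have hUT := hU _ (hf.isFace R)
  rw [hf.firstDisplacement_isFace R] at hUT
  -- On the displacement the functional `-∑ i ∈ D, a i` is maximal exactly on that slice.
  let D : Finset (Fin n) := (Finset.univ.erase j).erase s
  have hface := isFace_of_forall_le (P := {x | x ∈ P ∧ ∀ i ∈ R, toReal (a i) ⬝ᵥ (x - v) = 1})
    (c := -∑ i ∈ D, toReal (a i)) (v := corner v w R)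
    ⟨hV, fun i hi => by rw [hf.dotProduct_corner_sub, if_pos hi]⟩
    fun x hx => hf.sum_le hx.1 hx.2 D
  obtain ⟨hdim, htri⟩ := hf.isUnimodularTriangle hjs
    (exists_corner_eq_toReal (hL.vertices v hf.vertex) w R)
  suffices hT : {x | x ∈ {x | x ∈ P ∧ ∀ i ∈ R, toReal (a i) ⬝ᵥ (x - v) = 1} ∧
      (-∑ i ∈ D, toReal (a i)) ⬝ᵥ x = (-∑ i ∈ D, toReal (a i)) ⬝ᵥ corner v w R} =
      convexHull ℝ {corner v w R, corner v w R + toReal (w j), corner v w R + toReal (w s)} by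
    rw [hT] at hface
    exact hUT _ hface hdim htri
  refine subset_antisymm (fun x hx => ?_) (convexHull_min ?_ ?_)
  · have hcoord := hf.eq_of_sum_le hx.1.1 hx.1.2 hx.2.ge
    have hα := hf.nonneg x hx.1.1 j
    have hβ := hf.nonneg x hx.1.1 s
    have hxeq : x = corner v w R + ((toReal (a j) ⬝ᵥ (x - v)) • toReal (w j) +
        (toReal (a s) ⬝ᵥ (x - v)) • toReal (w s)) := by
      rw [← sub_left_inj (a := v), add_sub_right_comm]
      refine hf.ext fun i => ?_
      rw [dotProduct_add, hf.dotProduct_corner_sub, dotProduct_add, dotProduct_smul,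
        dotProduct_smul, hf.dual_real, hf.dual_real]
      by_cases hij : i = j
      · simp [hij, hjR, hjs]
      by_cases his : i = s
      · simp [his, hsR, hjs.symm]
      · simp [hij, his, hcoord i (by simp [D, hij, his])]
    have hγ := h.right.nonneg x hx.1.1 j
    generalize toReal (a j) ⬝ᵥ (x - v) = α at hα hxeq
    generalize toReal (a s) ⬝ᵥ (x - v) = β at hβ hxeq
    rw [hxeq] at hγ ⊢
    simp only [dotProduct_sub, dotProduct_add, dotProduct_smul, h.dotProduct_right, hY, smul_eq_mul]
      at hγ
    have := (convex_convexHull ℝ {corner v w R, corner v w R + toReal (w j),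
      corner v w R + toReal (w s)}).sum_mem (t := Finset.univ) (w := ![1 - α - β, α, β])
      (z := ![corner v w R, corner v w R + toReal (w j), corner v w R + toReal (w s)])
      (by simp only [Finset.mem_univ, true_imp_iff, Fin.forall_fin_succ]; simp [hα, hβ]; linarith)
      (by simp [Fin.sum_univ_three]; ring)
      (fun i _ => subset_convexHull ℝ _ (by fin_cases i <;> simp))
    convert this using 1
    simp only [Fin.sum_univ_three, Matrix.cons_val]
    module
  · have hdw : ∀ i, i ∉ D → (-∑ k ∈ D, toReal (a k)) ⬝ᵥ toReal (w i) = 0 := fun i hi => by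
      rw [neg_dotProduct, sum_dotProduct, neg_eq_zero]
      refine Finset.sum_eq_zero fun k hk => ?_
      rw [hf.dual_real, if_neg (by rintro rfl; exact hi hk)]
    have hcR : ∀ T, R ⊆ T → ∀ i ∈ R, toReal (a i) ⬝ᵥ (corner v w T - v) = 1 := fun T hT i hi => by
      rw [hf.dotProduct_corner_sub, if_pos (hT hi)]
    rintro _ (rfl | rfl | rfl)
    · exact ⟨⟨hV, hcR R subset_rfl⟩, rfl⟩
    · rw [← corner_insert v w hjR]
      refine ⟨⟨hVX, hcR _ (Finset.subset_insert _ _)⟩, ?_⟩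
      rw [corner_insert v w hjR, dotProduct_add, hdw j (by simp [D]), add_zero]
    · rw [← corner_insert v w hsR]
      refine ⟨⟨hVY, hcR _ (Finset.subset_insert _ _)⟩, ?_⟩
      rw [corner_insert v w hsR, dotProduct_add, hdw s (by simp [D]), add_zero]
  · intro x hx y hy α β hα hβ hαβ
    obtain rfl : α = 1 - β := by linarith
    refine ⟨⟨hP.polytope.convex hx.1.1 hy.1.1 hα hβ hαβ, fun i hi => ?_⟩, ?_⟩
    · have h1 := hx.1.2 i hi
      have h2 := hy.1.2 i hi
      simp only [dotProduct_sub, dotProduct_add, dotProduct_smul, smul_eq_mul] at *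
      linear_combination (1 - β) * h1 + β * h2
    · rw [dotProduct_add, dotProduct_smul, dotProduct_smul, hx.2, hy.2, smul_eq_mul, smul_eq_mul]
      ring

end LatticePolytope

open LatticePolytope in
theorem theorem4 (n : ℕ) (P : Set (Fin n → ℝ))
    (hsmooth : LatticePolytope.IsSmooth P) (hlattice : LatticePolytope.IsLattice P) :
    List.TFAE [
      LatticePolytope.IsDeeplySmooth P,
      ∀ F, LatticePolytope.IsFace P F →
        LatticePolytope.NormallyIsomorphic (LatticePolytope.firstDisplacement P F) F,
      LatticePolytope.IsUTFree P ∧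
        ∀ F, LatticePolytope.IsFace P F →
          LatticePolytope.IsUTFree (LatticePolytope.firstDisplacement P F)] := by
  rw [isDeeplySmooth_iff hsmooth hlattice]
  tfae_have 1 → 2 := fun H F hF => normallyIsomorphic_firstDisplacement hsmooth H hF
  tfae_have 1 → 3 := fun H => by
    have hU := fun F hF => isUTFree_firstDisplacement hsmooth hlattice H (F := F) hF
    refine ⟨fun T hT => ?_, hU⟩
    obtain ⟨v, -, hv, -⟩ := hsmooth.polytope.exists_isVertex_maximizer hT 0
    obtain ⟨hface, hself⟩ := firstDisplacement_self hsmooth hv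
    have hPU := hU P hface
    rw [hself] at hPU
    exact hPU T hT
  tfae_have 2 → 1 := fun H => corner_mem_of_corner_ne hsmooth hlattice
    fun v w a j v' w' a' S h hj _ ih =>
      corner_ne_of_normallyIsomorphic H h hj (ih v w a h.left S le_rfl)
  tfae_have 3 → 1 := fun H => corner_mem_of_corner_ne hsmooth hlattice
    fun v w a j v' w' a' S h hj hne ih =>
      corner_ne_of_isUTFree hsmooth hlattice H.2 h hj hne ih
  tfae_finish
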